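/- Let $d\ge 1$ and let $\Omega\subset\mathbb R^d$ be a bounded open set that is tiling: there is a sequence $\Omega_1,\Omega_2,\dots$ of pairwise disjoint isometric copies of $\Omega$ (images of $\Omega$ under isometries of $\mathbb R^d$) such that $\mathbb R^d\setminus\bigcup_{j}\Omega_j$ has Lebesgue measure zero. Let $W_2^1(\Omega)$ be the Sobolev space of the (real- or complex-valued) functions $u\in L_2(\Omega)$ whose weak gradient lies in $L_2(\Omega)$, with the norm $\left(\int_\Omega(|u|^2+|\nabla u|^2)\,dx\right)^{1/2}$, and assume that the embedding $W_2^1(\Omega)\subset L_2(\Omega)$ is compact. The Neumann Laplacian of $\Omega$ is the operator $-\Delta_N$ in $L_2(\Omega)$ defined by the quadratic form $\int_\Omega|\nabla\varphi|^2dx$, $\varphi\in W_2^1(\Omega)$; that is, $-\Delta_N u=f$ means that $u\in W_2^1(\Omega)$, $f\in L_2(\Omega)$ and $\int_\Omega\nabla u\cdot\overline{\nabla v}\,dx=\int_\Omega f\,\overline v\,dx$ for all $v\in W_2^1(\Omega)$. Then its eigenvalues, repeated according to multiplicity, form a sequence $\mu_1(\Omega)\le\mu_2(\Omega)\le\dots$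 with $\mu_k(\Omega)\to+\infty$, and Pólya's conjecture holds for it: $$\mu_{k+1}(\Omega)\le\frac{4\pi^2}{(\omega_d|\Omega|)^{2/d}}\,k^{2/d}\qquad\text{for every integer }k\ge 0,$$ and, for every $\lambda>0$, the number $N_N(\lambda,\Omega):=\#\{k:\mu_k(\Omega)<\lambda\}$ is finite and satisfies $$N_N(\lambda,\Omega)\ge\frac{\omega_d|\Omega|}{(2\pi)^d}\,\lambda^{d/2}.$$ Here $|\Omega|$ is the Lebesgue measure of $\Omega$ and $\omega_d$ is the volume of the unit ball of $\mathbb R^d$. -/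

import Mathlib

open MeasureTheory Filter Topology
open scoped ContDiff

noncomputable section

/-- `Ω ⊆ ℝ^d` is tiling: `ℝ^d` is, up to a null set, the union of countably many pairwise
disjoint images of `Ω` under isometries of `ℝ^d` (reflections allowed). -/
def IsTilingSet {d : ℕ} (Ω : Set (EuclideanSpace ℝ (Fin d))) : Prop :=
  ∃ g : ℕ → (EuclideanSpace ℝ (Fin d) ≃ᵢ EuclideanSpace ℝ (Fin d)),
    (∀ j k : ℕ, j ≠ k → Disjoint (g j '' Ω) (g k '' Ω)) ∧
    volume ((⋃ j : ℕ, g j '' Ω)ᶜ) = 0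

/-- The space `L_2(Ω)` of (classes of) square-integrable `𝕜`-valued functions on `Ω`. -/
abbrev LTwo (𝕜 : Type*) [RCLike 𝕜] {d : ℕ} (Ω : Set (EuclideanSpace ℝ (Fin d))) : Type _ :=
  Lp 𝕜 2 (volume.restrict Ω)

/-- `g` is the weak partial derivative of `u` in `Ω` in the `i`-th coordinate direction:
`∫_Ω u ∂_i φ = - ∫_Ω g φ` for every `φ ∈ C_0^∞(Ω)`. -/
def HasWeakPartialDeriv {𝕜 : Type*} [RCLike 𝕜] {d : ℕ} (Ω : Set (EuclideanSpace ℝ (Fin d)))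
    (i : Fin d) (u g : LTwo 𝕜 Ω) : Prop :=
  ∀ φ : EuclideanSpace ℝ (Fin d) → ℝ,
    ContDiff ℝ ∞ φ → HasCompactSupport φ → tsupport φ ⊆ Ω →
      ∫ x in Ω, fderiv ℝ φ x (EuclideanSpace.single i 1) • u x = - ∫ x in Ω, φ x • g x

theorem integrable_smul_lTwo {𝕜 : Type*} [RCLike 𝕜] {d : ℕ}
    {Ω : Set (EuclideanSpace ℝ (Fin d))} (u : LTwo 𝕜 Ω)
    {ψ : EuclideanSpace ℝ (Fin d) → ℝ} (hc : Continuous ψ) (hs : HasCompactSupport ψ) :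
    Integrable (fun x => ψ x • u x) (volume.restrict Ω) :=
  memLp_one_iff_integrable.mp
    ((Lp.memLp u).smul (hc.memLp_of_hasCompactSupport (p := 2) hs))

theorem continuous_partialDeriv {d : ℕ} (i : Fin d) {φ : EuclideanSpace ℝ (Fin d) → ℝ}
    (hφ : ContDiff ℝ ∞ φ) :
    Continuous (fun x => fderiv ℝ φ x (EuclideanSpace.single i 1)) :=
  (hφ.continuous_fderiv (by simp)).clm_apply continuous_const

theorem HasWeakPartialDeriv.zero {𝕜 : Type*} [RCLike 𝕜] {d : ℕ}
    {Ω : Set (EuclideanSpace ℝ (Fin d))} (i : Fin d) :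
    HasWeakPartialDeriv Ω i (0 : LTwo 𝕜 Ω) 0 := by
  intro φ _ _ _
  have h0 : ∀ ψ : EuclideanSpace ℝ (Fin d) → ℝ,
      ∫ x in Ω, ψ x • (0 : LTwo 𝕜 Ω) x = 0 := by
    intro ψ
    refine integral_eq_zero_of_ae ?_
    filter_upwards [Lp.coeFn_zero 𝕜 2 (volume.restrict Ω)] with x hx
    rw [hx, Pi.zero_apply, smul_zero]
  rw [h0 (fun x => fderiv ℝ φ x (EuclideanSpace.single i 1)), h0 φ, neg_zero]

theorem integral_smul_lTwo_add {𝕜 : Type*} [RCLike 𝕜] {d : ℕ}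
    {Ω : Set (EuclideanSpace ℝ (Fin d))} (u v : LTwo 𝕜 Ω)
    {ψ : EuclideanSpace ℝ (Fin d) → ℝ} (hc : Continuous ψ) (hs : HasCompactSupport ψ) :
    ∫ x in Ω, ψ x • (u + v) x = (∫ x in Ω, ψ x • u x) + ∫ x in Ω, ψ x • v x := by
  rw [← integral_add (integrable_smul_lTwo u hc hs) (integrable_smul_lTwo v hc hs)]
  refine integral_congr_ae ?_
  filter_upwards [Lp.coeFn_add u v] with x hx
  rw [hx, Pi.add_apply, smul_add]

theorem integral_smul_lTwo_const_smul {𝕜 : Type*} [RCLike 𝕜] {d : ℕ}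
    {Ω : Set (EuclideanSpace ℝ (Fin d))} (c : 𝕜) (u : LTwo 𝕜 Ω)
    (ψ : EuclideanSpace ℝ (Fin d) → ℝ) :
    ∫ x in Ω, ψ x • (c • u) x = c • ∫ x in Ω, ψ x • u x := by
  rw [← integral_smul]
  refine integral_congr_ae ?_
  filter_upwards [Lp.coeFn_smul c u] with x hx
  simp [hx]

theorem HasWeakPartialDeriv.add {𝕜 : Type*} [RCLike 𝕜] {d : ℕ}
    {Ω : Set (EuclideanSpace ℝ (Fin d))} {i : Fin d} {u v g h : LTwo 𝕜 Ω}
    (hu : HasWeakPartialDeriv Ω i u g) (hv : HasWeakPartialDeriv Ω i v h) :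
    HasWeakPartialDeriv Ω i (u + v) (g + h) := by
  intro φ h1 h2 h3
  rw [integral_smul_lTwo_add u v (continuous_partialDeriv i h1)
      (h2.fderiv_apply ℝ _), integral_smul_lTwo_add g h h1.continuous h2,
    hu φ h1 h2 h3, hv φ h1 h2 h3, neg_add]

theorem HasWeakPartialDeriv.const_smul {𝕜 : Type*} [RCLike 𝕜] {d : ℕ}
    {Ω : Set (EuclideanSpace ℝ (Fin d))} {i : Fin d} {u g : LTwo 𝕜 Ω} (c : 𝕜)
    (hu : HasWeakPartialDeriv Ω i u g) :
    HasWeakPartialDeriv Ω i (c • u) (c • g) := by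
  intro φ h1 h2 h3
  rw [integral_smul_lTwo_const_smul c u
      (fun x => fderiv ℝ φ x (EuclideanSpace.single i 1)),
    integral_smul_lTwo_const_smul, hu φ h1 h2 h3, smul_neg]

/-- The Sobolev space `W_2^1(Ω)`.  An element is a function `u ∈ L_2(Ω)` together with its weak
gradient `(∂_1 u, …, ∂_d u) ∈ L_2(Ω)^d` (which is determined by `u`); the norm inherited from the
ambient Hilbert sum is `‖u‖² = ∫_Ω (|u|² + |∇u|²)`. -/
def sobolevSpace (𝕜 : Type*) [RCLike 𝕜] {d : ℕ} (Ω : Set (EuclideanSpace ℝ (Fin d))) :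
    Submodule 𝕜 (WithLp 2 (LTwo 𝕜 Ω × PiLp 2 (fun _ : Fin d => LTwo 𝕜 Ω))) where
  carrier := {w | ∀ i : Fin d, HasWeakPartialDeriv Ω i w.fst (w.snd i)}
  zero_mem' := fun i => HasWeakPartialDeriv.zero i
  add_mem' := fun hw hz i => (hw i).add (hz i)
  smul_mem' := fun c _ hw i => (hw i).const_smul c

/-- The embedding `W_2^1(Ω) ⊂ L_2(Ω)`. -/
def sobolevEmbedding (𝕜 : Type*) [RCLike 𝕜] {d : ℕ} (Ω : Set (EuclideanSpace ℝ (Fin d))) :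
    sobolevSpace 𝕜 Ω →L[𝕜] LTwo 𝕜 Ω :=
  (WithLp.fstL 2 𝕜 _ _).comp (sobolevSpace 𝕜 Ω).subtypeL

/-- The (graph of the) Neumann Laplacian of `Ω`: the operator in `L_2(Ω)` associated with the
quadratic form `∫_Ω |∇φ|²`, `φ ∈ W_2^1(Ω)`.  A pair `(u, f)` belongs to it iff `u ∈ W_2^1(Ω)` and
`∫_Ω ∇u · conj ∇v = ∫_Ω f conj v` for every `v ∈ W_2^1(Ω)`. -/
def neumannLaplacian (𝕜 : Type*) [RCLike 𝕜] {d : ℕ} (Ω : Set (EuclideanSpace ℝ (Fin d))) :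
    Submodule 𝕜 (LTwo 𝕜 Ω × LTwo 𝕜 Ω) where
  carrier := {p | ∃ w ∈ sobolevSpace 𝕜 Ω, w.fst = p.1 ∧
    ∀ v ∈ sobolevSpace 𝕜 Ω, inner 𝕜 v.snd w.snd = inner 𝕜 v.fst p.2}
  zero_mem' := ⟨0, zero_mem _, rfl, fun v _ => by simp⟩
  add_mem' := by
    rintro p q ⟨w, hw, hwp, hp⟩ ⟨z, hz, hzq, hq⟩
    refine ⟨w + z, add_mem hw hz, by simp [hwp, hzq], fun v hv => ?_⟩
    simp [inner_add_right, hp v hv, hq v hv]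
  smul_mem' := by
    rintro c p ⟨w, hw, hwp, hp⟩
    refine ⟨c • w, Submodule.smul_mem _ c hw, by simp [hwp], fun v hv => ?_⟩
    simp [inner_smul_right, hp v hv]

/-- The eigenspace `{u : -Δ_N u = t u}` of the Neumann Laplacian at `t ∈ ℝ`
(the zero space if `t` is not an eigenvalue). -/
def neumannEigenspace (𝕜 : Type*) [RCLike 𝕜] {d : ℕ} (Ω : Set (EuclideanSpace ℝ (Fin d)))
    (t : ℝ) : Submodule 𝕜 (LTwo 𝕜 Ω) :=
  (neumannLaplacian 𝕜 Ω).comap (LinearMap.prod LinearMap.id ((t : 𝕜) • LinearMap.id))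

/-- `μ 0 ≤ μ 1 ≤ μ 2 ≤ …`, `μ k → +∞`, is the sequence of all eigenvalues of the Neumann Laplacian
of `Ω`, each repeated according to its multiplicity.  Numbering starts at `0`, so `μ k` is the
`(k + 1)`-st eigenvalue. -/
structure IsNeumannEigenvalueSequence (𝕜 : Type*) [RCLike 𝕜] {d : ℕ}
    (Ω : Set (EuclideanSpace ℝ (Fin d))) (μ : ℕ → ℝ) : Prop where
  monotone : Monotone μ
  tendsto_atTop : Tendsto μ atTop atTop
  multiplicity : ∀ t : ℝ,
    {k : ℕ | μ k = t}.encard = Cardinal.toENat (Module.rank 𝕜 (neumannEigenspace 𝕜 Ω t))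

end

/-! The lower bound for the counting function comes from bracketing against a large cube. Extended
by zero, the Dirichlet sine modes of `(0, πR)^d` are Lipschitz on `ℝ^d`; restricted to a tile and
pulled back, they lie in `W_2^1(Ω)`. Take a combination of modes with eigenvalues below `a` that on
every tile is orthogonal to the Neumann eigenfunctions below `a`. Tile by tile its energy is at
least `a` times its mass, while on the cube orthogonality of the modes makes the energy strictly
smaller unless the combination is zero. Hence the number of modes is at most the number of tiles
meeting the cube times `N`, the dimension of the Neumann spectral subspace of `Ω`
(`card_le_card_mul_finrank_neumannSpectralSubspace`).

The modes are positive lattice points in a ball, at least `ω_d (√a R - √d)^d / 2^d` of them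
(`volume_ball_le_two_pow_mul_card`). The tiles are disjoint and lie in a cube of side `πR + 2 diam
Ω`, which bounds their number (`exists_finset_tiles`). Dividing by `R^d` and letting `R → ∞` removes
both errors, because `Ω` stays fixed: `N ≥ ω_d |Ω| a^{d/2} / (2π)^d`, with no remainder.

The spectral theory is read off the compact symmetric operator `J J*`, where `J` is the Sobolev
embedding. The lower bound also shows that the dimensions are unbounded, so the eigenvalue sequence
exists, and at `a = μ k` it inverts to the bound on eigenvalues. -/

noncomputable section

/-! ### Spectral theory of compact symmetric operators. -/

section CompactSymmetric

open Module.End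

variable {𝕜 : Type*} [RCLike 𝕜] {E : Type*} [NormedAddCommGroup E] [InnerProductSpace 𝕜 E]

/-- A vector in a sum of eigenspaces of a symmetric operator is a finite orthogonal sum of
eigenvectors. -/
theorem exists_eigenvector_decomposition {T : E →L[𝕜] E} (hT : T.IsSymmetric)
    {ι : Type*} {ν : ι → 𝕜} (hν : Function.Injective ν) {v : E}
    (hv : v ∈ ⨆ i, eigenspace (T : Module.End 𝕜 E) (ν i)) :
    ∃ (s : Finset ι) (l : ι → E), ‖v‖ ^ 2 = ∑ i ∈ s, ‖l i‖ ^ 2 ∧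
      ‖T v‖ ^ 2 = ∑ i ∈ s, ‖ν i‖ ^ 2 * ‖l i‖ ^ 2 ∧
      inner 𝕜 v (T v) = ∑ i ∈ s, ν i * (‖l i‖ : 𝕜) ^ 2 ∧ ∀ i, T (l i) = ν i • l i := by
  obtain ⟨f, hf, rfl⟩ := (Submodule.mem_iSup_iff_exists_finsupp _ _).mp hv
  have hO := (LinearMap.IsSymmetric.orthogonalFamily_eigenspaces hT).comp hν
  have hTf : ∀ i, T (f i) = ν i • f i := fun i => mem_eigenspace_iff.mp (hf i)
  have hsum : T (f.sum fun _ x => x) = ∑ i ∈ f.support, ν i • f i := by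
    simp only [Finsupp.sum, map_sum, hTf]
  have h1 := hO.norm_sum (fun i => ⟨f i, hf i⟩) f.support
  have h2 := hO.norm_sum (fun i => ν i • ⟨f i, hf i⟩) f.support
  have h3 := hO.inner_sum (fun i => ⟨f i, hf i⟩) (fun i => ν i • ⟨f i, hf i⟩) f.support
  refine ⟨f.support, f, by simpa [Finsupp.sum] using h1, ?_, ?_, hTf⟩
  · rw [hsum]
    simpa [norm_smul, mul_pow] using h2
  · rw [hsum]
    simpa [Finsupp.sum, inner_smul_right] using h3

variable [CompleteSpace E]

/-- The eigenspaces of a compact symmetric operator belonging to eigenvalues above a positive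
level span a finite-dimensional space. -/
theorem finiteDimensional_iSup_eigenspace {T : E →L[𝕜] E} (hT : T.IsSymmetric)
    (hc : IsCompactOperator T) {c : ℝ} (hc0 : 0 < c) :
    FiniteDimensional 𝕜
      (⨆ s : {s : ℝ // c < s}, eigenspace (T : Module.End 𝕜 E) ((s : ℝ) : 𝕜) : Submodule 𝕜 E) := by
  set F : Submodule 𝕜 E :=
    ⨆ s : {s : ℝ // c < s}, eigenspace (T : Module.End 𝕜 E) ((s : ℝ) : 𝕜)
  -- `T` is bounded below on the span, hence on its closure. A compact operator that is also a
  -- closed embedding makes the identity compact, which forces finite dimension.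
  have hF : ∀ v ∈ F, c * ‖v‖ ≤ ‖T v‖ := by
    intro v hv
    obtain ⟨s, l, h1, h2, -, -⟩ := exists_eigenvector_decomposition hT
      (ν := fun s : {s : ℝ // c < s} => ((s : ℝ) : 𝕜))
      (fun a b h => Subtype.ext (RCLike.ofReal_injective h)) hv
    refine le_of_sq_le_sq ?_ (norm_nonneg _)
    rw [mul_pow, h1, h2, Finset.mul_sum]
    refine Finset.sum_le_sum fun i _ => ?_
    refine mul_le_mul_of_nonneg_right ?_ (sq_nonneg _)
    rw [RCLike.norm_ofReal, sq_abs]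
    exact pow_le_pow_left₀ hc0.le i.2.le 2
  have hF' : ∀ v ∈ F.topologicalClosure, c * ‖v‖ ≤ ‖T v‖ := by
    intro v hv
    have hcl : IsClosed {v : E | c * ‖v‖ ≤ ‖T v‖} :=
      isClosed_le (by fun_prop) (by fun_prop)
    exact closure_minimal hF hcl hv
  let S : F.topologicalClosure →L[𝕜] E := T.comp F.topologicalClosure.subtypeL
  have hS : IsCompactOperator S := hc.comp_clm F.topologicalClosure.subtypeL
  have hanti : AntilipschitzWith (Real.toNNReal c)⁻¹ S := by
    refine AddMonoidHomClass.antilipschitz_of_bound S fun v => ?_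
    rw [NNReal.coe_inv, Real.coe_toNNReal c hc0.le, ← div_eq_inv_mul, le_div_iff₀ hc0, mul_comm]
    exact hF' v v.2
  have hcomplete : CompleteSpace F.topologicalClosure :=
    F.isClosed_topologicalClosure.completeSpace_coe
  have hemb := hanti.isClosedEmbedding S.uniformContinuous
  obtain ⟨K, hK, hK0⟩ := hS
  have hid : IsCompactOperator (id : F.topologicalClosure → F.topologicalClosure) :=
    ⟨S ⁻¹' K, hemb.isCompact_preimage hK, by simpa using hK0⟩
  have hfin : FiniteDimensional 𝕜 F.topologicalClosure := .of_isCompactOperator_id hid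
  exact Submodule.finiteDimensional_of_le F.le_topologicalClosure

/-- Variational bound for a compact symmetric operator on the orthogonal complement of the
eigenspaces belonging to eigenvalues above `c`. -/
theorem re_inner_le_of_mem_orthogonal_iSup_eigenspace {T : E →L[𝕜] E} (hT : T.IsSymmetric)
    (hc : IsCompactOperator T) {c : ℝ} {v : E}
    (hv : v ∈ (⨆ s : {s : ℝ // c < s},
      eigenspace (T : Module.End 𝕜 E) ((s : ℝ) : 𝕜) : Submodule 𝕜 E)ᗮ) :
    RCLike.re (inner 𝕜 v (T v)) ≤ c * ‖v‖ ^ 2 := by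
  set F : Submodule 𝕜 E :=
    ⨆ s : {s : ℝ // c < s}, eigenspace (T : Module.End 𝕜 E) ((s : ℝ) : 𝕜)
  have hFinv : ∀ w ∈ F, T w ∈ F := by
    intro w hw
    refine Submodule.iSup_induction _ (motive := fun w => T w ∈ F) hw ?_ ?_ ?_
    · intro i x hx
      have hTx : T x = ((i : ℝ) : 𝕜) • x := mem_eigenspace_iff.mp hx
      rw [hTx]
      exact F.smul_mem _ (Submodule.mem_iSup_of_mem i hx)
    · simp
    · intro x y hx hy
      rw [map_add]
      exact F.add_mem hx hy
  have hGinv : ∀ w ∈ Fᗮ, T w ∈ Fᗮ := by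
    intro w hw x hx
    have h := hT x w
    simp only [ContinuousLinearMap.coe_coe] at h
    rw [← h]
    exact hw _ (hFinv x hx)
  -- Eigenvectors of the restriction span a dense subspace of `Fᗮ`. One with eigenvalue above `c`
  -- would lie in both `F` and `Fᗮ`, so the quadratic form is at most `c` on that span and, by
  -- continuity, on all of `Fᗮ`.
  let S : Fᗮ →L[𝕜] Fᗮ := T.restrict hGinv
  have hS : IsCompactOperator S := hc.restrict' hGinv
  have hS' : S.IsSymmetric := LinearMap.IsSymmetric.restrict_invariant hT hGinv
  have hdense : (⨆ μ, eigenspace (S : Module.End 𝕜 Fᗮ) μ).topologicalClosure = ⊤ :=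
    Submodule.topologicalClosure_eq_top_iff.mpr
      (S.orthogonalComplement_iSup_eigenspaces_eq_bot hS hS')
  have key : ∀ w ∈ ⨆ μ, eigenspace (S : Module.End 𝕜 Fᗮ) μ,
      RCLike.re (inner 𝕜 w (S w)) ≤ c * ‖w‖ ^ 2 := by
    intro w hw
    obtain ⟨s, l, h1, -, h2, h3⟩ := exists_eigenvector_decomposition hS'
      (ν := fun s : 𝕜 => s) Function.injective_id hw
    rw [h2, h1, map_sum, Finset.mul_sum]
    refine Finset.sum_le_sum fun i _ => ?_
    by_cases hi : l i = 0
    · simp [hi]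
    have heig : HasEigenvalue (S : Module.End 𝕜 Fᗮ) i :=
      hasEigenvalue_of_hasEigenvector ⟨mem_eigenspace_iff.mpr (h3 i), hi⟩
    have hreal : ((RCLike.re i : ℝ) : 𝕜) = i :=
      RCLike.conj_eq_iff_re.mp (LinearMap.IsSymmetric.conj_eigenvalue_eq_self hS' heig)
    rw [← hreal, ← RCLike.ofReal_pow, ← RCLike.ofReal_mul, RCLike.ofReal_re]
    refine mul_le_mul_of_nonneg_right ?_ (sq_nonneg _)
    by_contra! hlt
    have hTl : T (l i : E) = i • (l i : E) := congrArg Subtype.val (h3 i)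
    have hmem : (l i : E) ∈ F := by
      refine Submodule.mem_iSup_of_mem ⟨RCLike.re i, hlt⟩ (mem_eigenspace_iff.mpr ?_)
      rw [hreal]
      exact hTl
    have h0 : inner 𝕜 (l i : E) (l i : E) = 0 := (l i).2 _ hmem
    exact hi (Subtype.ext (inner_self_eq_zero.mp h0))
  have hcl : IsClosed {w : Fᗮ | RCLike.re (inner 𝕜 w (S w)) ≤ c * ‖w‖ ^ 2} :=
    isClosed_le (by fun_prop) (by fun_prop)
  have hmem : (⟨v, hv⟩ : Fᗮ) ∈ (⨆ μ, eigenspace (S : Module.End 𝕜 Fᗮ) μ).topologicalClosure := by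
    rw [hdense]
    trivial
  exact closure_minimal key hcl hmem

end CompactSymmetric

/-! ### Independent sums and enumeration of multiplicities. -/

/-- The dimension of a finite independent sum of subspaces. -/
theorem finrank_iSup_of_iSupIndep {𝕜 : Type*} [Field 𝕜] {E : Type*} [AddCommGroup E] [Module 𝕜 E]
    {ι : Type*} [Fintype ι] {N : ι → Submodule 𝕜 E} (h : iSupIndep N)
    [∀ i, FiniteDimensional 𝕜 (N i)] :
    Module.finrank 𝕜 (⨆ i, N i : Submodule 𝕜 E) = ∑ i, Module.finrank 𝕜 (N i) := by
  classical
  rw [Submodule.iSup_eq_range_dfinsupp_lsum,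
    LinearMap.finrank_range_of_inj h.dfinsupp_lsum_injective]
  exact Module.finrank_directSum (R := 𝕜) (fun i => N i)

/-- A family of multiplicities on the line, finite below every level and of infinite total mass,
 is realised by a monotone sequence. -/
theorem exists_monotone_enumeration {m : ℝ → ℕ}
    (hfin : ∀ a, {t | t < a ∧ m t ≠ 0}.Finite) (hinf : {t | m t ≠ 0}.Infinite) :
    ∃ μ : ℕ → ℝ, Monotone μ ∧ Tendsto μ atTop atTop ∧ ∀ t, {k | μ k = t}.encard = m t := by
  -- One index per unit of multiplicity, ordered first by level. This is an infinite linear order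
  -- with finite initial segments, hence isomorphic to `ℕ`; the sequence reads off the level.
  let ι := Σₗ t : ℝ, Fin (m t)
  have hfin' : ∀ a : ℝ, {x : ι | (ofLex x).1 < a}.Finite := by
    intro a
    refine ((hfin a).biUnion (t := fun t => Set.range fun i : Fin (m t) => (toLex ⟨t, i⟩ : ι))
      fun t _ => Set.finite_range _).subset ?_
    intro x hx
    obtain ⟨t, i⟩ := x
    exact Set.mem_biUnion (x := t) ⟨hx, fun h => (Fin.cast h i).elim0⟩ ⟨i, rfl⟩
  have hmono : ∀ x y : ι, x ≤ y → (ofLex x).1 ≤ (ofLex y).1 := by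
    intro x y hxy
    rcases Sigma.Lex.le_def.mp hxy with h | ⟨h, -⟩
    · exact h.le
    · exact h.le
  have hIic : ∀ b : ι, (Set.Iic b).Finite := fun b =>
    (hfin' ((ofLex b).1 + 1)).subset fun x hx => lt_of_le_of_lt (hmono x b hx) (lt_add_one _)
  have : Infinite ι := by
    refine Set.infinite_univ_iff.mp fun h => hinf ?_
    refine (h.image fun x : ι => (ofLex x).1).subset fun t ht => ?_
    exact ⟨toLex ⟨t, ⟨0, Nat.pos_of_ne_zero ht⟩⟩, trivial, rfl⟩
  have : LocallyFiniteOrder ι :=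
    LocallyFiniteOrder.ofFiniteIcc fun a b => (hIic b).subset Set.Icc_subset_Iic_self
  have : NoMaxOrder ι := ⟨fun a => by
    by_contra! h
    exact Set.infinite_univ ((hIic a).subset fun x _ => not_lt.mp (h x))⟩
  obtain ⟨x₀⟩ := (inferInstance : Nonempty ι)
  obtain ⟨b, hb, hbmin⟩ :=
    Set.exists_min_image (Set.Iic x₀) id (hIic x₀) ⟨x₀, Set.mem_Iic.mpr le_rfl⟩
  let _ : OrderBot ι :=
    { bot := b
      bot_le := fun x => (le_total x x₀).elim (hbmin x) fun h => hb.trans h }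
  let e : ι ≃o ℕ :=
    letI := LinearLocallyFiniteOrder.succOrder ι
    letI := LinearLocallyFiniteOrder.predOrder ι
    orderIsoNatOfLinearSuccPredArch
  have hμ : Monotone fun k => (ofLex (e.symm k)).1 := fun j k hjk =>
    hmono _ _ (e.symm.monotone hjk)
  refine ⟨fun k => (ofLex (e.symm k)).1, hμ, ?_, ?_⟩
  · refine tendsto_atTop_atTop_of_monotone hμ fun a => ?_
    by_contra! h
    refine Set.infinite_univ (α := ι) ((hfin' a).subset fun x _ => ?_)
    simpa using h (e x)
  · intro t
    have himg : {k | (ofLex (e.symm k)).1 = t} =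
        (fun i : Fin (m t) => e (toLex ⟨t, i⟩)) '' Set.univ := by
      ext k
      constructor
      · rintro rfl
        exact ⟨(ofLex (e.symm k)).2, trivial, by simp⟩
      · rintro ⟨i, -, rfl⟩
        simp
    rw [himg, Function.Injective.encard_image, Set.encard_univ]
    · simp
    · intro i j hij
      have h := toLex.injective (e.injective hij)
      simpa using h

/-! ### The Neumann Laplacian through its resolvent. -/

section Neumann

open Module.End

variable {𝕜 : Type*} [RCLike 𝕜] {d : ℕ} {Ω : Set (EuclideanSpace ℝ (Fin d))}

/-- Pairing with a test function is the inner product with its `L_2` class. This makes the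
weak-derivative conditions closed, hence `W_2^1(Ω)` complete, as the adjoint of the embedding
requires. -/
theorem continuous_integral_smul_lTwo {ψ : EuclideanSpace ℝ (Fin d) → ℝ} (hc : Continuous ψ)
    (hs : HasCompactSupport ψ) : Continuous fun u : LTwo 𝕜 Ω => ∫ x in Ω, ψ x • u x := by
  have hψ : MemLp (fun x => (ψ x : 𝕜)) 2 (volume.restrict Ω) :=
    (hc.memLp_of_hasCompactSupport (p := 2) hs).ofReal
  have h : ∀ u : LTwo 𝕜 Ω, ∫ x in Ω, ψ x • u x = inner 𝕜 hψ.toLp u := by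
    intro u
    rw [L2.inner_def]
    refine integral_congr_ae ?_
    filter_upwards [hψ.coeFn_toLp] with x hx
    rw [hx, RCLike.inner_apply, RCLike.conj_ofReal, RCLike.real_smul_eq_coe_mul, mul_comm]
  simp only [h]
  fun_prop

theorem isClosed_sobolevSpace : IsClosed (sobolevSpace 𝕜 Ω : Set (WithLp 2 (LTwo 𝕜 Ω ×
    PiLp 2 (fun _ : Fin d => LTwo 𝕜 Ω)))) := by
  have h : (sobolevSpace 𝕜 Ω : Set (WithLp 2 (LTwo 𝕜 Ω × PiLp 2 (fun _ : Fin d => LTwo 𝕜 Ω)))) =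
      ⋂ (i : Fin d), ⋂ (φ : EuclideanSpace ℝ (Fin d) → ℝ), ⋂ (_ : ContDiff ℝ ∞ φ),
      ⋂ (_ : HasCompactSupport φ), ⋂ (_ : tsupport φ ⊆ Ω),
      {w | ∫ x in Ω, fderiv ℝ φ x (EuclideanSpace.single i 1) • w.fst x =
        - ∫ x in Ω, φ x • w.snd i x} := by
    ext w
    simp only [Set.mem_iInter]
    rfl
  rw [h]
  refine isClosed_iInter fun i => isClosed_iInter fun φ => isClosed_iInter fun h1 =>
    isClosed_iInter fun h2 => isClosed_iInter fun _ => isClosed_eq ?_ ?_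
  · exact (continuous_integral_smul_lTwo (continuous_partialDeriv i h1)
      (h2.fderiv_apply ℝ _)).comp (WithLp.fstL 2 𝕜 _ _).continuous
  · refine ((continuous_integral_smul_lTwo h1.continuous h2).comp ?_).neg
    exact (PiLp.continuous_apply 2 _ i).comp (WithLp.sndL 2 𝕜 _ _).continuous

instance : CompleteSpace (sobolevSpace 𝕜 Ω) := isClosed_sobolevSpace.completeSpace_coe

variable (𝕜 Ω) in
/-- The adjoint `L_2(Ω) → W_2^1(Ω)` of the embedding. -/
def sobolevEmbeddingAdjoint : LTwo 𝕜 Ω →L[𝕜] sobolevSpace 𝕜 Ω :=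
  ContinuousLinearMap.adjoint (𝕜 := 𝕜) (E := sobolevSpace 𝕜 Ω) (F := LTwo 𝕜 Ω)
    (sobolevEmbedding 𝕜 Ω)

theorem sobolevEmbeddingAdjoint_inner_right (v : sobolevSpace 𝕜 Ω) (f : LTwo 𝕜 Ω) :
    inner 𝕜 v (sobolevEmbeddingAdjoint 𝕜 Ω f) = inner 𝕜 v.1.fst f := by
  rw [sobolevEmbeddingAdjoint, ContinuousLinearMap.adjoint_inner_right]
  rfl

variable (𝕜 Ω) in
/-- The operator `(1 - Δ_N)⁻¹` in `L_2(Ω)`. -/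
def neumannResolvent : LTwo 𝕜 Ω →L[𝕜] LTwo 𝕜 Ω :=
  (sobolevEmbedding 𝕜 Ω).comp (sobolevEmbeddingAdjoint 𝕜 Ω)

theorem neumannResolvent_apply (f : LTwo 𝕜 Ω) :
    neumannResolvent 𝕜 Ω f = (sobolevEmbeddingAdjoint 𝕜 Ω f).1.fst := rfl

theorem inner_neumannResolvent_right (u v : LTwo 𝕜 Ω) :
    inner 𝕜 u (neumannResolvent 𝕜 Ω v) =
      inner 𝕜 (sobolevEmbeddingAdjoint 𝕜 Ω u) (sobolevEmbeddingAdjoint 𝕜 Ω v) := by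
  rw [← inner_conj_symm, neumannResolvent_apply, ← sobolevEmbeddingAdjoint_inner_right,
    inner_conj_symm]

theorem neumannResolvent_isSymmetric : (neumannResolvent 𝕜 Ω).IsSymmetric := by
  intro u v
  rw [ContinuousLinearMap.coe_coe, ← inner_conj_symm, inner_neumannResolvent_right,
    inner_conj_symm, inner_neumannResolvent_right]

theorem neumannResolvent_isCompact (hcompact : IsCompactOperator (sobolevEmbedding 𝕜 Ω)) :
    IsCompactOperator (neumannResolvent 𝕜 Ω) :=
  hcompact.comp_clm (sobolevEmbeddingAdjoint 𝕜 Ω)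

theorem sobolevSpace_inner (v w : sobolevSpace 𝕜 Ω) :
    inner 𝕜 v w = inner 𝕜 v.1.fst w.1.fst + inner 𝕜 v.1.snd w.1.snd :=
  WithLp.prod_inner_apply v.1 w.1

theorem sobolevSpace_norm_sq (w : sobolevSpace 𝕜 Ω) :
    ‖w‖ ^ 2 = ‖w.1.fst‖ ^ 2 + ‖w.1.snd‖ ^ 2 :=
  WithLp.prod_norm_sq_eq_of_L2 w.1

/-- Adding the `L_2` product of `v` and `u` to both sides of the form identity turns its left side
into the `W_2^1` inner product, so the identity says that `w` is the adjoint of the embedding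
applied to `u + f`. -/
theorem mem_neumannLaplacian_iff {u f : LTwo 𝕜 Ω} :
    (u, f) ∈ neumannLaplacian 𝕜 Ω ↔ neumannResolvent 𝕜 Ω (u + f) = u := by
  constructor
  · rintro ⟨w, hw, rfl, h⟩
    have : sobolevEmbeddingAdjoint 𝕜 Ω (w.fst + f) = ⟨w, hw⟩ := by
      refine ext_inner_left 𝕜 fun v => ?_
      rw [sobolevEmbeddingAdjoint_inner_right, sobolevSpace_inner, h v v.2, ← inner_add_right]
    rw [neumannResolvent_apply, this]
  · intro h
    set w := sobolevEmbeddingAdjoint 𝕜 Ω (u + f) with hw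
    have hwu : w.1.fst = u := h
    refine ⟨w.1, w.2, hwu, fun v hv => ?_⟩
    have h1 := sobolevEmbeddingAdjoint_inner_right ⟨v, hv⟩ (u + f)
    rw [← hw, sobolevSpace_inner, hwu, inner_add_right] at h1
    exact add_left_cancel h1

theorem mem_neumannEigenspace_iff {u : LTwo 𝕜 Ω} {t : ℝ} :
    u ∈ neumannEigenspace 𝕜 Ω t ↔ ((t + 1 : ℝ) : 𝕜) • neumannResolvent 𝕜 Ω u = u := by
  have h : u ∈ neumannEigenspace 𝕜 Ω t ↔ (u, (t : 𝕜) • u) ∈ neumannLaplacian 𝕜 Ω := Iff.rfl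
  rw [h, mem_neumannLaplacian_iff, ← (neumannResolvent 𝕜 Ω).map_smul]
  simp [add_smul, add_comm]

theorem neumannEigenspace_eq_eigenspace {t : ℝ} (ht : t + 1 ≠ 0) :
    neumannEigenspace 𝕜 Ω t =
      eigenspace (neumannResolvent 𝕜 Ω : Module.End 𝕜 (LTwo 𝕜 Ω)) (((t + 1)⁻¹ : ℝ) : 𝕜) := by
  have ht' : ((t + 1 : ℝ) : 𝕜) ≠ 0 := by exact_mod_cast ht
  ext u
  rw [mem_neumannEigenspace_iff, mem_eigenspace_iff, RCLike.ofReal_inv]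
  constructor
  · intro h
    rw [eq_inv_smul_iff₀ ht']
    exact h
  · intro h
    rwa [eq_inv_smul_iff₀ ht'] at h

/-- Testing the form identity with the eigenfunction itself gives `‖∇u‖² = t ‖u‖²`. -/
theorem neumannEigenspace_eq_bot {t : ℝ} (ht : t < 0) : neumannEigenspace 𝕜 Ω t = ⊥ := by
  refine (Submodule.eq_bot_iff _).mpr ?_
  rintro u ⟨w, hw, hwu, h⟩
  have h1 := congrArg RCLike.re (h w hw)
  have h2 : inner 𝕜 w.fst ((LinearMap.prod (LinearMap.id : LTwo 𝕜 Ω →ₗ[𝕜] LTwo 𝕜 Ω)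
      ((t : 𝕜) • LinearMap.id)) u).2 = (t : 𝕜) * inner 𝕜 u u := by
    rw [hwu]
    exact inner_smul_right _ _ _
  rw [h2, inner_self_eq_norm_sq, inner_self_eq_norm_sq_to_K, ← RCLike.ofReal_pow,
    ← RCLike.ofReal_mul, RCLike.ofReal_re] at h1
  have h3 : ‖u‖ ^ 2 = 0 := by
    by_contra hne
    have hpos : 0 < ‖u‖ ^ 2 := lt_of_le_of_ne (sq_nonneg _) (Ne.symm hne)
    nlinarith [sq_nonneg ‖w.snd‖]
  simpa using h3

theorem neumannEigenspace_iSupIndep : iSupIndep (neumannEigenspace 𝕜 Ω) := by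
  -- With the convention `0⁻¹ = 0`, the map `t ↦ (t + 1)⁻¹` is injective on all of `ℝ`. The
  -- degenerate point `t = -1` is harmless because its Neumann eigenspace is zero.
  have h := (eigenspaces_iSupIndep (R := 𝕜) (neumannResolvent 𝕜 Ω : Module.End 𝕜 (LTwo 𝕜 Ω))).comp
    (f := fun t : ℝ => (((t + 1)⁻¹ : ℝ) : 𝕜)) (fun a b hab => by
      simpa using hab)
  refine h.mono fun t => ?_
  by_cases ht : t + 1 = 0
  · rw [neumannEigenspace_eq_bot (by linarith)]
    exact bot_le
  · exact (neumannEigenspace_eq_eigenspace ht).le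

variable (𝕜 Ω) in
/-- The sum of the eigenspaces of the Neumann Laplacian with eigenvalues below `a`. -/
def neumannSpectralSubspace (a : ℝ) : Submodule 𝕜 (LTwo 𝕜 Ω) :=
  ⨆ t : {t : ℝ // t < a}, neumannEigenspace 𝕜 Ω t

theorem neumannSpectralSubspace_eq {a : ℝ} (ha : 0 < a) :
    neumannSpectralSubspace 𝕜 Ω a = ⨆ s : {s : ℝ // (a + 1)⁻¹ < s},
      eigenspace (neumannResolvent 𝕜 Ω : Module.End 𝕜 (LTwo 𝕜 Ω)) ((s : ℝ) : 𝕜) := by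
  refine le_antisymm (iSup_le fun t => ?_) (iSup_le fun s => ?_)
  · rcases lt_or_ge (t : ℝ) 0 with h | h
    · rw [neumannEigenspace_eq_bot h]
      exact bot_le
    · rw [neumannEigenspace_eq_eigenspace (by positivity)]
      refine le_iSup (fun s : {s : ℝ // (a + 1)⁻¹ < s} =>
        eigenspace (neumannResolvent 𝕜 Ω : Module.End 𝕜 (LTwo 𝕜 Ω)) ((s : ℝ) : 𝕜))
        ⟨((t : ℝ) + 1)⁻¹, ?_⟩
      exact inv_strictAnti₀ (by positivity) (by linarith [t.2])
  · have hs : 0 < (s : ℝ) := lt_trans (by positivity) s.2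
    have h1 : (s : ℝ) = ((((s : ℝ)⁻¹ - 1) + 1)⁻¹ : ℝ) := by simp
    have h2 : (s : ℝ)⁻¹ - 1 < a := by
      have := inv_strictAnti₀ (by positivity) s.2
      rw [inv_inv] at this
      linarith
    rw [h1, ← neumannEigenspace_eq_eigenspace (by simpa using hs.ne')]
    exact le_iSup (fun t : {t : ℝ // t < a} => neumannEigenspace 𝕜 Ω t) ⟨_, h2⟩

theorem finiteDimensional_neumannSpectralSubspace
    (hcompact : IsCompactOperator (sobolevEmbedding 𝕜 Ω)) {a : ℝ} (ha : 0 < a) :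
    FiniteDimensional 𝕜 (neumannSpectralSubspace 𝕜 Ω a) := by
  rw [neumannSpectralSubspace_eq ha]
  exact finiteDimensional_iSup_eigenspace neumannResolvent_isSymmetric
    (neumannResolvent_isCompact hcompact) (by positivity)

theorem finiteDimensional_neumannEigenspace
    (hcompact : IsCompactOperator (sobolevEmbedding 𝕜 Ω)) (t : ℝ) :
    FiniteDimensional 𝕜 (neumannEigenspace 𝕜 Ω t) := by
  have h : FiniteDimensional 𝕜 (⨆ s : {s : ℝ // s < |t| + 1}, neumannEigenspace 𝕜 Ω s :
      Submodule 𝕜 (LTwo 𝕜 Ω)) :=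
    finiteDimensional_neumannSpectralSubspace hcompact (a := |t| + 1) (by positivity)
  exact Submodule.finiteDimensional_of_le
    (le_iSup (fun s : {s : ℝ // s < |t| + 1} => neumannEigenspace 𝕜 Ω s)
      ⟨t, lt_of_le_of_lt (le_abs_self t) (lt_add_one _)⟩)

/-- Variational lower bound for the Neumann form on the orthogonal complement of the spectral
subspace. -/
theorem mul_norm_sq_le_of_mem_orthogonal_neumannSpectralSubspace
    (hcompact : IsCompactOperator (sobolevEmbedding 𝕜 Ω)) {a : ℝ} (ha : 0 < a)
    (w : sobolevSpace 𝕜 Ω) (hw : w.1.fst ∈ (neumannSpectralSubspace 𝕜 Ω a)ᗮ) :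
    a * ‖w.1.fst‖ ^ 2 ≤ ‖w.1.snd‖ ^ 2 := by
  set f : LTwo 𝕜 Ω := w.1.fst with hf
  rw [neumannSpectralSubspace_eq ha] at hw
  have h1 := re_inner_le_of_mem_orthogonal_iSup_eigenspace neumannResolvent_isSymmetric
    (neumannResolvent_isCompact hcompact) hw
  -- The resolvent bound passes to the form by Cauchy–Schwarz: `‖f‖² = ⟨w, g⟩ ≤ ‖w‖ ‖g‖` and `(a +
  -- 1) ‖g‖² ≤ ‖f‖²`, so `(a + 1) ‖f‖² ≤ ‖w‖² = ‖f‖² + ‖∇w‖²`.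
  set g := sobolevEmbeddingAdjoint 𝕜 Ω f with hg
  have h2 : inner 𝕜 f (neumannResolvent 𝕜 Ω f) = inner 𝕜 g g :=
    inner_neumannResolvent_right f f
  rw [h2, inner_self_eq_norm_sq, inv_mul_eq_div, le_div_iff₀ (by positivity)] at h1
  have h3 : ‖f‖ ^ 2 ≤ ‖w‖ * ‖g‖ := by
    have h4 : inner 𝕜 w g = inner 𝕜 f f := by
      rw [hg, sobolevEmbeddingAdjoint_inner_right]
    rw [← inner_self_eq_norm_sq (𝕜 := 𝕜), ← h4]
    exact re_inner_le_norm w g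
  have h5 := sobolevSpace_norm_sq w
  rw [← hf] at h5
  rcases eq_or_lt_of_le (sq_nonneg ‖f‖) with h0 | h0
  · rw [← h0, mul_zero]
    positivity
  · have h6 : (‖f‖ ^ 2) ^ 2 ≤ ‖w‖ ^ 2 * ‖g‖ ^ 2 := by
      rw [← mul_pow]
      exact pow_le_pow_left₀ h0.le h3 2
    have h7 : (a + 1) * (‖f‖ ^ 2) ^ 2 ≤ ‖w‖ ^ 2 * ‖f‖ ^ 2 := by
      nlinarith [sq_nonneg ‖w‖]
    have h8 : (a + 1) * ‖f‖ ^ 2 ≤ ‖w‖ ^ 2 := by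
      refine le_of_mul_le_mul_right ?_ h0
      linarith [h7]
    linarith

/-- The eigenspaces are independent and sit in one finite-dimensional spectral subspace, so only
finitely many are nonzero. The level `|a| + 1` merely ensures positivity. -/
theorem finite_neumannEigenspace_ne_bot
    (hcompact : IsCompactOperator (sobolevEmbedding 𝕜 Ω)) (a : ℝ) :
    {t : ℝ | t < a ∧ neumannEigenspace 𝕜 Ω t ≠ ⊥}.Finite := by
  have hfd := finiteDimensional_neumannSpectralSubspace hcompact (a := |a| + 1) (by positivity)
  set F := neumannSpectralSubspace 𝕜 Ω (|a| + 1)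
  have hle : ∀ t : {t : ℝ // t < a}, neumannEigenspace 𝕜 Ω t ≤ F := fun t =>
    le_iSup (fun s : {s : ℝ // s < |a| + 1} => neumannEigenspace 𝕜 Ω s)
      ⟨t, by linarith [t.2, le_abs_self a]⟩
  have hind : iSupIndep fun t : {t : ℝ // t < a} => (neumannEigenspace 𝕜 Ω t).comap F.subtype := by
    intro t
    have h1 := neumannEigenspace_iSupIndep (𝕜 := 𝕜) (Ω := Ω).comp
      (Subtype.val_injective (p := fun t : ℝ => t < a)) t
    rw [Submodule.disjoint_def] at h1 ⊢
    intro x hx hx'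
    refine Subtype.ext (h1 x hx ?_)
    have h2 : (⨆ (j) (_ : j ≠ t), (neumannEigenspace 𝕜 Ω j).comap F.subtype) ≤
        (⨆ (j : {t : ℝ // t < a}) (_ : j ≠ t), neumannEigenspace 𝕜 Ω j).comap F.subtype :=
      iSup₂_le fun j hj => Submodule.comap_mono
        (le_iSup₂ (f := fun (j : {t : ℝ // t < a}) (_ : j ≠ t) => neumannEigenspace 𝕜 Ω j) j hj)
    exact h2 hx'
  have h := WellFoundedGT.finite_ne_bot_of_iSupIndep hind
  refine (h.image Subtype.val).subset ?_
  rintro t ⟨ht, hne⟩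
  refine ⟨⟨t, ht⟩, fun hbot => hne ?_, rfl⟩
  have h2 := Submodule.map_comap_subtype F (neumannEigenspace 𝕜 Ω t)
  have h3 : (neumannEigenspace 𝕜 Ω t).comap F.subtype = ⊥ := hbot
  rw [h3, Submodule.map_bot, inf_eq_right.mpr (hle ⟨t, ht⟩)] at h2
  exact h2.symm

theorem finrank_neumannSpectralSubspace
    (hcompact : IsCompactOperator (sobolevEmbedding 𝕜 Ω)) (a : ℝ) :
    Module.finrank 𝕜 (neumannSpectralSubspace 𝕜 Ω a) =
      ∑ t ∈ (finite_neumannEigenspace_ne_bot hcompact a).toFinset,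
        Module.finrank 𝕜 (neumannEigenspace 𝕜 Ω t) := by
  set s := (finite_neumannEigenspace_ne_bot hcompact a).toFinset with hs
  have h1 : neumannSpectralSubspace 𝕜 Ω a = ⨆ t : s, neumannEigenspace 𝕜 Ω t := by
    refine le_antisymm (iSup_le fun t => ?_) (iSup_le fun t => ?_)
    · by_cases h : neumannEigenspace 𝕜 Ω t = ⊥
      · rw [h]
        exact bot_le
      · exact le_iSup (fun t : s => neumannEigenspace 𝕜 Ω t) ⟨t, by simpa [hs] using ⟨t.2, h⟩⟩
    · have ht : (t : ℝ) < a := by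
        have := t.2
        simp only [hs, Set.Finite.mem_toFinset, Set.mem_ofPred_eq] at this
        exact this.1
      exact le_iSup (fun t : {t : ℝ // t < a} => neumannEigenspace 𝕜 Ω t) ⟨t, ht⟩
  have := fun t : s => finiteDimensional_neumannEigenspace hcompact (t : ℝ)
  rw [h1, finrank_iSup_of_iSupIndep (N := fun t : s => neumannEigenspace 𝕜 Ω t)
    (neumannEigenspace_iSupIndep.comp (Subtype.val_injective (p := fun t => t ∈ s)))]
  exact Finset.sum_coe_sort s fun t => Module.finrank 𝕜 (neumannEigenspace 𝕜 Ω t)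

theorem toENat_rank_neumannEigenspace
    (hcompact : IsCompactOperator (sobolevEmbedding 𝕜 Ω)) (t : ℝ) :
    Cardinal.toENat (Module.rank 𝕜 (neumannEigenspace 𝕜 Ω t)) =
      Module.finrank 𝕜 (neumannEigenspace 𝕜 Ω t) := by
  have := finiteDimensional_neumannEigenspace hcompact t
  rw [← Module.finrank_eq_rank, Cardinal.toENat_nat]

theorem IsNeumannEigenvalueSequence.finite_lt {μ : ℕ → ℝ}
    (hμ : IsNeumannEigenvalueSequence 𝕜 Ω μ) (a : ℝ) : {k | μ k < a}.Finite := by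
  have h := hμ.tendsto_atTop.eventually (eventually_ge_atTop a)
  rw [← Nat.cofinite_eq_atTop] at h
  simpa [Filter.Eventually, Filter.mem_cofinite, Set.compl_def] using h

/-- The number of eigenvalues below a level is the dimension of the spectral subspace. -/
theorem IsNeumannEigenvalueSequence.ncard_lt {μ : ℕ → ℝ}
    (hμ : IsNeumannEigenvalueSequence 𝕜 Ω μ)
    (hcompact : IsCompactOperator (sobolevEmbedding 𝕜 Ω)) (a : ℝ) :
    {k | μ k < a}.ncard = Module.finrank 𝕜 (neumannSpectralSubspace 𝕜 Ω a) := by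
  classical
  set s := (finite_neumannEigenspace_ne_bot hcompact a).toFinset with hs
  have hcard : ∀ t, {k | μ k = t}.encard = Module.finrank 𝕜 (neumannEigenspace 𝕜 Ω t) := fun t => by
    rw [hμ.multiplicity, toENat_rank_neumannEigenspace hcompact]
  have hmaps : ∀ k ∈ (hμ.finite_lt a).toFinset, μ k ∈ s := by
    intro k hk
    have hk' : μ k < a := by simpa using hk
    refine (Set.Finite.mem_toFinset _).mpr ⟨hk', fun hbot => ?_⟩
    have h1 := hcard (μ k)
    rw [hbot, finrank_bot, Nat.cast_zero, Set.encard_eq_zero] at h1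
    exact (Set.ext_iff.mp h1 k).mp rfl
  rw [finrank_neumannSpectralSubspace hcompact, Set.ncard_eq_toFinset_card _ (hμ.finite_lt a),
    Finset.card_eq_sum_card_fiberwise hmaps]
  refine Finset.sum_congr rfl fun t ht => ?_
  have hta : t < a := ((Set.Finite.mem_toFinset _).mp ht).1
  have h2 : (({k ∈ (hμ.finite_lt a).toFinset | μ k = t} : Finset ℕ) : Set ℕ) = {k | μ k = t} := by
    ext k
    simp only [Finset.coe_filter, Set.Finite.mem_toFinset, Set.mem_ofPred_eq]
    exact ⟨fun h => h.2, fun h => ⟨h ▸ hta, h⟩⟩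
  have h3 := hcard t
  rw [← h2, Set.encard_coe_eq_coe_finsetCard] at h3
  exact_mod_cast h3

/-- If the spectral subspaces have unbounded dimension, the eigenvalues form a sequence tending to
infinity. -/
theorem exists_isNeumannEigenvalueSequence
    (hcompact : IsCompactOperator (sobolevEmbedding 𝕜 Ω))
    (hunb : ∀ n : ℕ, ∃ a, n < Module.finrank 𝕜 (neumannSpectralSubspace 𝕜 Ω a)) :
    ∃ μ : ℕ → ℝ, IsNeumannEigenvalueSequence 𝕜 Ω μ := by
  have hiff : ∀ t, Module.finrank 𝕜 (neumannEigenspace 𝕜 Ω t) ≠ 0 ↔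
      neumannEigenspace 𝕜 Ω t ≠ ⊥ := fun t => by
    have := finiteDimensional_neumannEigenspace hcompact t
    rw [Ne, Submodule.finrank_eq_zero]
  obtain ⟨μ, h1, h2, h3⟩ := exists_monotone_enumeration
    (m := fun t => Module.finrank 𝕜 (neumannEigenspace 𝕜 Ω t)) (fun a => by
      simpa only [hiff] using finite_neumannEigenspace_ne_bot hcompact a) (by
      simp only [hiff]
      -- Finitely many nonzero eigenspaces would bound the dimension of every spectral subspace by
      -- their total dimension.
      intro hfin
      obtain ⟨a, ha⟩ := hunb (∑ t ∈ hfin.toFinset, Module.finrank 𝕜 (neumannEigenspace 𝕜 Ω t))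
      rw [finrank_neumannSpectralSubspace hcompact] at ha
      refine absurd ha (not_lt.mpr (Finset.sum_le_sum_of_subset ?_))
      intro t ht
      exact (Set.Finite.mem_toFinset _).mpr ((Set.Finite.mem_toFinset _).mp ht).2)
  exact ⟨μ, h1, h2, fun t => by rw [h3, toENat_rank_neumannEigenspace hcompact]⟩

end Neumann

/-! ### Compactly supported Lipschitz functions as elements of `W_2^1(Ω)`. -/

section Lipschitz

variable {d : ℕ} {f f' : EuclideanSpace ℝ (Fin d) → ℝ} {C C' : NNReal}

theorem lineDeriv_eq_zero_of_notMem_tsupport {x v : EuclideanSpace ℝ (Fin d)}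
    (hx : x ∉ tsupport f) : lineDeriv ℝ f x v = 0 := by
  have h : f =ᶠ[𝓝 x] fun _ => 0 := notMem_tsupport_iff_eventuallyEq.mp hx
  rw [h.lineDeriv_eq]
  simp [lineDeriv]

theorem LipschitzWith.memLp_lineDeriv_of_hasCompactSupport (hf : LipschitzWith C f)
    (hs : HasCompactSupport f) (v : EuclideanSpace ℝ (Fin d)) (p : ENNReal) :
    MemLp (fun x => lineDeriv ℝ f x v) p volume :=
  (hf.memLp_lineDeriv v).mono_exponent_of_measure_support_ne_top
    (s := tsupport f) (fun _ hx => lineDeriv_eq_zero_of_notMem_tsupport hx)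
    hs.measure_lt_top.ne le_top

theorem LipschitzWith.integrable_lineDeriv_mul (hf : LipschitzWith C f) (hs : HasCompactSupport f)
    (hf' : LipschitzWith C' f') (hs' : HasCompactSupport f') (v : EuclideanSpace ℝ (Fin d)) :
    Integrable (fun x => lineDeriv ℝ f x v * lineDeriv ℝ f' x v) volume :=
  (hf.memLp_lineDeriv_of_hasCompactSupport hs v 2).integrable_mul
    (hf'.memLp_lineDeriv_of_hasCompactSupport hs' v 2)

/-- The pointwise inner product of the gradients of `f` and `f'`. -/
def gradInner (f f' : EuclideanSpace ℝ (Fin d) → ℝ) (x : EuclideanSpace ℝ (Fin d)) : ℝ :=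
  ∑ i, lineDeriv ℝ f x (EuclideanSpace.single i 1) * lineDeriv ℝ f' x (EuclideanSpace.single i 1)

theorem LipschitzWith.integrable_gradInner (hf : LipschitzWith C f) (hs : HasCompactSupport f)
    (hf' : LipschitzWith C' f') (hs' : HasCompactSupport f') :
    Integrable (gradInner f f') volume :=
  integrable_finsetSum _ fun _ _ => hf.integrable_lineDeriv_mul hs hf' hs' _

variable (𝕜 : Type*) [RCLike 𝕜] (Ω : Set (EuclideanSpace ℝ (Fin d)))

theorem LipschitzWith.memLp_ofReal (hf : LipschitzWith C f) (hs : HasCompactSupport f) :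
    MemLp (fun x => (f x : 𝕜)) 2 (volume.restrict Ω) :=
  (hf.continuous.memLp_of_hasCompactSupport hs).ofReal

theorem LipschitzWith.memLp_lineDeriv_ofReal (hf : LipschitzWith C f) (hs : HasCompactSupport f)
    (v : EuclideanSpace ℝ (Fin d)) :
    MemLp (fun x => ((lineDeriv ℝ f x v : ℝ) : 𝕜)) 2 (volume.restrict Ω) :=
  ((hf.memLp_lineDeriv_of_hasCompactSupport hs v 2).restrict Ω).ofReal

theorem setIntegral_smul_toLp_ofReal {μ : Measure (EuclideanSpace ℝ (Fin d))}
    {u ψ : EuclideanSpace ℝ (Fin d) → ℝ} (hu : MemLp (fun x => (u x : 𝕜)) 2 μ) :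
    ∫ x, ψ x • (hu.toLp _ : Lp 𝕜 2 μ) x ∂μ = ((∫ x, ψ x * u x ∂μ : ℝ) : 𝕜) := by
  rw [← integral_ofReal]
  refine integral_congr_ae ?_
  filter_upwards [hu.coeFn_toLp] with x hx
  rw [hx, RCLike.real_smul_eq_coe_mul, RCLike.ofReal_mul]

/-- The restriction to `Ω` of a compactly supported Lipschitz function, as an element of
`W_2^1(Ω)`. -/
def LipschitzWith.toSobolev (hf : LipschitzWith C f) (hs : HasCompactSupport f) :
    sobolevSpace 𝕜 Ω :=
  ⟨WithLp.toLp 2 ((hf.memLp_ofReal 𝕜 Ω hs).toLp, WithLp.toLp 2 fun i =>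
    (hf.memLp_lineDeriv_ofReal 𝕜 Ω hs (EuclideanSpace.single i 1)).toLp), by
    intro i φ h1 h2 h3
    obtain ⟨D, hD⟩ := ContDiff.lipschitzWith_of_hasCompactSupport h2 h1 (by simp)
    set e : EuclideanSpace ℝ (Fin d) := EuclideanSpace.single i 1
    -- Integration by parts takes place on all of `ℝ^d`; the test function is supported in `Ω`, so
    -- the boundary of `Ω` plays no role.
    have hparts := hf.integral_lineDeriv_mul_eq (μ := volume) hD h2 e
    have hL : ∀ x v, lineDeriv ℝ φ x v = fderiv ℝ φ x v := fun x v =>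
      (h1.differentiable (by simp) x).lineDeriv_eq_fderiv
    refine (setIntegral_smul_toLp_ofReal 𝕜 (hf.memLp_ofReal 𝕜 Ω hs)).trans ?_
    refine Eq.trans ?_
      (congrArg Neg.neg (setIntegral_smul_toLp_ofReal 𝕜 (hf.memLp_lineDeriv_ofReal 𝕜 Ω hs e))).symm
    rw [← RCLike.ofReal_neg,
      setIntegral_eq_integral_of_forall_compl_eq_zero,
      setIntegral_eq_integral_of_forall_compl_eq_zero]
    · congr 1
      simp only [mul_comm (φ _)]
      rw [hparts, ← integral_neg]
      simp only [hL, map_neg, neg_mul, neg_neg]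
    · intro x hx
      rw [image_eq_zero_of_notMem_tsupport fun h => hx (h3 h), zero_mul]
    · intro x hx
      rw [← hL, lineDeriv_eq_zero_of_notMem_tsupport fun h => hx (h3 h), zero_mul]⟩

theorem inner_toLp_ofReal {μ : Measure (EuclideanSpace ℝ (Fin d))}
    {u v : EuclideanSpace ℝ (Fin d) → ℝ} (hu : MemLp (fun x => (u x : 𝕜)) 2 μ)
    (hv : MemLp (fun x => (v x : 𝕜)) 2 μ) :
    inner 𝕜 hu.toLp hv.toLp = ((∫ x, u x * v x ∂μ : ℝ) : 𝕜) := by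
  rw [L2.inner_def, ← integral_ofReal]
  refine integral_congr_ae ?_
  filter_upwards [hu.coeFn_toLp, hv.coeFn_toLp] with x hx hx'
  rw [hx, hx', RCLike.inner_apply, RCLike.conj_ofReal, RCLike.ofReal_mul, mul_comm]

theorem LipschitzWith.inner_toSobolev_fst (hf : LipschitzWith C f) (hs : HasCompactSupport f)
    (hf' : LipschitzWith C' f') (hs' : HasCompactSupport f') :
    inner 𝕜 (hf.toSobolev 𝕜 Ω hs).1.fst (hf'.toSobolev 𝕜 Ω hs').1.fst =
      ((∫ x in Ω, f x * f' x : ℝ) : 𝕜) :=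
  inner_toLp_ofReal 𝕜 (hf.memLp_ofReal 𝕜 Ω hs) (hf'.memLp_ofReal 𝕜 Ω hs')

theorem LipschitzWith.inner_toSobolev_snd (hf : LipschitzWith C f) (hs : HasCompactSupport f)
    (hf' : LipschitzWith C' f') (hs' : HasCompactSupport f') :
    inner 𝕜 (hf.toSobolev 𝕜 Ω hs).1.snd (hf'.toSobolev 𝕜 Ω hs').1.snd =
      ((∫ x in Ω, gradInner f f' x : ℝ) : 𝕜) := by
  simp only [gradInner]
  rw [integral_finsetSum _ fun i _ => (hf.integrable_lineDeriv_mul hs hf' hs' _).integrableOn,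
    RCLike.ofReal_sum, PiLp.inner_apply]
  exact Finset.sum_congr rfl fun i _ => inner_toLp_ofReal 𝕜
    (hf.memLp_lineDeriv_ofReal 𝕜 Ω hs _) (hf'.memLp_lineDeriv_ofReal 𝕜 Ω hs' _)

end Lipschitz

/-! ### Isometry invariance and summation over tiles. -/

section Isometry

variable {d : ℕ}

theorem IsometryEquiv.measurePreserving_volume
    (g : EuclideanSpace ℝ (Fin d) ≃ᵢ EuclideanSpace ℝ (Fin d)) :
    MeasurePreserving g volume volume := by
  have h := (measurePreserving_add_right (volume : Measure (EuclideanSpace ℝ (Fin d)))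
    (g 0)).comp g.toRealLinearIsometryEquiv.measurePreserving
  have hg : ⇑g = (fun x => x + g 0) ∘ g.toRealLinearIsometryEquiv := by
    funext x
    simp
  rwa [← hg] at h

theorem IsometryEquiv.lineDeriv_comp (g : EuclideanSpace ℝ (Fin d) ≃ᵢ EuclideanSpace ℝ (Fin d))
    (f : EuclideanSpace ℝ (Fin d) → ℝ) (x v : EuclideanSpace ℝ (Fin d)) :
    lineDeriv ℝ (f ∘ g) x v = lineDeriv ℝ f (g x) (g.toRealLinearIsometryEquiv v) := by
  have hg : ∀ y, g y = g.toRealLinearIsometryEquiv y + g 0 := by simp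
  simp only [lineDeriv, Function.comp]
  congr 1
  ext t
  rw [hg (x + t • v), hg x, map_add, map_smul]
  congr 1
  abel

/-- Both sums equal the inner product of the Riesz representatives of `L` and `L'`. -/
theorem sum_dual_mul_dual_eq (b b' : OrthonormalBasis (Fin d) ℝ (EuclideanSpace ℝ (Fin d)))
    (L L' : EuclideanSpace ℝ (Fin d) →L[ℝ] ℝ) :
    ∑ i, L (b i) * L' (b i) = ∑ i, L (b' i) * L' (b' i) := by
  have h : ∀ b : OrthonormalBasis (Fin d) ℝ (EuclideanSpace ℝ (Fin d)),
      ∑ i, L (b i) * L' (b i) = inner ℝ ((InnerProductSpace.toDual ℝ _).symm L)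
        ((InnerProductSpace.toDual ℝ _).symm L') := by
    intro b
    rw [← b.sum_inner_mul_inner]
    refine Finset.sum_congr rfl fun i _ => ?_
    rw [real_inner_comm _ (b i)]
    simp
  rw [h, h]

/-- By Rademacher's theorem both functions are differentiable at `g x` for almost every `x`. There
the linear part of `g` only replaces the standard basis by another orthonormal one. -/
theorem gradInner_comp_ae {f f' : EuclideanSpace ℝ (Fin d) → ℝ} {C C' : NNReal}
    (hf : LipschitzWith C f) (hf' : LipschitzWith C' f')
    (g : EuclideanSpace ℝ (Fin d) ≃ᵢ EuclideanSpace ℝ (Fin d)) :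
    ∀ᵐ x, gradInner (f ∘ g) (f' ∘ g) x = gradInner f f' (g x) := by
  have h1 := g.measurePreserving_volume.quasiMeasurePreserving.ae
    (hf.ae_differentiableAt (μ := volume))
  have h2 := g.measurePreserving_volume.quasiMeasurePreserving.ae
    (hf'.ae_differentiableAt (μ := volume))
  filter_upwards [h1, h2] with x hx hx'
  have h := sum_dual_mul_dual_eq
    ((EuclideanSpace.basisFun (Fin d) ℝ).map g.toRealLinearIsometryEquiv)
    (EuclideanSpace.basisFun (Fin d) ℝ) (fderiv ℝ f (g x)) (fderiv ℝ f' (g x))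
  simp only [gradInner, g.lineDeriv_comp, hx.lineDeriv_eq_fderiv, hx'.lineDeriv_eq_fderiv]
  simpa using h

/-- Each term is an integral over a tile. The tiles exhaust space up to a null set, and those
outside `s` miss the set that carries `G`. -/
theorem sum_setIntegral_comp_eq_integral {Ω : Set (EuclideanSpace ℝ (Fin d))}
    (hΩ : MeasurableSet Ω) {g : ℕ → EuclideanSpace ℝ (Fin d) ≃ᵢ EuclideanSpace ℝ (Fin d)}
    (hdisj : ∀ j k, j ≠ k → Disjoint (g j '' Ω) (g k '' Ω))
    (hcover : volume (⋃ j, g j '' Ω)ᶜ = 0) {G : EuclideanSpace ℝ (Fin d) → ℝ}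
    (hG : Integrable G) {K : Set (EuclideanSpace ℝ (Fin d))} (hK : ∀ x ∉ K, G x = 0)
    {s : Finset ℕ} (hs : ∀ j ∉ s, Disjoint (g j '' Ω) K) :
    ∑ j ∈ s, ∫ x in Ω, G (g j x) = ∫ x, G x := by
  have hmeas : ∀ j, MeasurableSet (g j '' Ω) := fun j =>
    (g j).toHomeomorph.measurableEmbedding.measurableSet_image.mpr hΩ
  have h1 : ∀ j, ∫ x in Ω, G (g j x) = ∫ x in g j '' Ω, G x := fun j =>
    ((g j).measurePreserving_volume.setIntegral_image_emb
      (g j).toHomeomorph.measurableEmbedding G Ω).symm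
  simp only [h1]
  rw [← integral_biUnion_finset s (fun j _ => hmeas j) (fun j _ k _ hjk => hdisj j k hjk)
    fun j _ => hG.integrableOn]
  refine setIntegral_eq_integral_of_ae_compl_eq_zero ?_
  have h2 : ∀ᵐ x, x ∈ ⋃ j, g j '' Ω := by
    rw [ae_iff]
    exact hcover
  filter_upwards [h2] with x hx hxs
  obtain ⟨j, hj⟩ := Set.mem_iUnion.mp hx
  refine hK x fun hxK => ?_
  have hjs : j ∉ s := fun h => hxs (Set.mem_biUnion h hj)
  exact Set.disjoint_left.mp (hs j hjs) hj hxK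

end Isometry

/-! ### Sine modes on an interval. -/

section BoxSine

open Real

theorem integral_cos_int_mul_div {R : ℝ} (hR : 0 < R) (m : ℤ) :
    ∫ t in (0 : ℝ)..π * R, cos (m / R * t) = if m = 0 then π * R else 0 := by
  split_ifs with h
  · simp [h]
  · have hm : (m : ℝ) / R ≠ 0 := div_ne_zero (by exact_mod_cast h) hR.ne'
    rw [intervalIntegral.integral_comp_mul_left (fun x => cos x) hm, integral_cos]
    have h1 : (m : ℝ) / R * (π * R) = m * π := by field_simp
    rw [h1, sin_int_mul_pi]
    simp

/-- The Dirichlet eigenfunction `sin ((k + 1) t / R)` of the interval `(0, π R)`, extended by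
zero. -/
def boxSine (R : ℝ) (k : ℕ) (t : ℝ) : ℝ := sin ((k + 1) / R * max 0 (min t (π * R)))

/-- The derivative of `boxSine`, extended by zero. -/
def boxCosine (R : ℝ) (k : ℕ) (t : ℝ) : ℝ :=
  (Set.Ioo 0 (π * R)).indicator (fun t => (k + 1) / R * cos ((k + 1) / R * t)) t

theorem boxSine_of_mem {R : ℝ} (k : ℕ) {t : ℝ} (ht : t ∈ Set.Icc 0 (π * R)) :
    boxSine R k t = sin ((k + 1) / R * t) := by
  rw [boxSine, min_eq_left ht.2, max_eq_right ht.1]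

theorem boxSine_of_notMem {R : ℝ} (hR : 0 < R) (k : ℕ) {t : ℝ} (ht : t ∉ Set.Ioo 0 (π * R)) :
    boxSine R k t = 0 := by
  have hπR : 0 ≤ π * R := by positivity
  rcases le_or_gt t 0 with h | h
  · rw [boxSine, max_eq_left ((min_le_left _ _).trans h), mul_zero, sin_zero]
  · have h' : π * R ≤ t := not_lt.mp fun h2 => ht ⟨h, h2⟩
    rw [boxSine, min_eq_right h', max_eq_right hπR]
    have h1 : ((k : ℝ) + 1) / R * (π * R) = ((k + 1 : ℕ) : ℝ) * π := by
      push_cast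
      field_simp
    rw [h1, sin_nat_mul_pi]

theorem abs_boxSine_le_one (R : ℝ) (k : ℕ) (t : ℝ) : |boxSine R k t| ≤ 1 := abs_sin_le_one _

/-- Clamping the argument, rather than cutting off the sine, makes this a composition of Lipschitz
maps. -/
theorem lipschitzWith_boxSine (R : ℝ) (k : ℕ) :
    LipschitzWith ‖((k : ℝ) + 1) / R‖₊ (boxSine R k) := by
  have h1 : LipschitzWith 1 fun t : ℝ => max 0 (min t (π * R)) :=
    (LipschitzWith.id.min_const _).const_max _
  have h2 := (lipschitzWith_smul (((k : ℝ) + 1) / R)).comp h1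
  have h3 := Real.lipschitzWith_sin.comp h2
  rwa [one_mul, mul_one] at h3

theorem hasDerivAt_boxSine {R : ℝ} (hR : 0 < R) (k : ℕ) {t : ℝ} (h0 : t ≠ 0) (h1 : t ≠ π * R) :
    HasDerivAt (boxSine R k) (boxCosine R k t) t := by
  by_cases ht : t ∈ Set.Ioo 0 (π * R)
  · have h2 : HasDerivAt (fun t : ℝ => sin ((k + 1) / R * t))
        (cos ((k + 1) / R * t) * ((k + 1) / R * 1)) t :=
      ((hasDerivAt_id t).const_mul _).sin
    rw [boxCosine, Set.indicator_of_mem ht]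
    rw [mul_one, mul_comm] at h2
    refine h2.congr_of_eventuallyEq ?_
    filter_upwards [isOpen_Ioo.mem_nhds ht] with s hs
    exact boxSine_of_mem k (Set.Ioo_subset_Icc_self hs)
  · have h3 : t ∈ (Set.Icc 0 (π * R))ᶜ := fun h =>
      ht ⟨lt_of_le_of_ne h.1 h0.symm, lt_of_le_of_ne h.2 h1⟩
    rw [boxCosine, Set.indicator_of_notMem ht]
    refine (hasDerivAt_const t (0 : ℝ)).congr_of_eventuallyEq ?_
    filter_upwards [isClosed_Icc.isOpen_compl.mem_nhds h3] with s hs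
    exact boxSine_of_notMem hR k fun h => hs (Set.Ioo_subset_Icc_self h)

theorem integral_eq_intervalIntegral_of_indicator {a b : ℝ} (hab : a ≤ b) {f g : ℝ → ℝ}
    (h0 : ∀ t ∉ Set.Ioo a b, f t = 0) (h1 : ∀ t ∈ Set.Ioo a b, f t = g t) :
    ∫ t, f t = ∫ t in a..b, g t := by
  rw [← setIntegral_eq_integral_of_forall_compl_eq_zero h0, intervalIntegral.integral_of_le hab,
    integral_Ioc_eq_integral_Ioo]
  exact setIntegral_congr_fun measurableSet_Ioo h1

theorem integral_boxSine_mul {R : ℝ} (hR : 0 < R) (k l : ℕ) :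
    ∫ t, boxSine R k t * boxSine R l t = if k = l then π * R / 2 else 0 := by
  have hπR : 0 ≤ π * R := by positivity
  rw [integral_eq_intervalIntegral_of_indicator hπR
    (g := fun t => (1 / 2) * (cos (((k - l : ℤ) : ℝ) / R * t) -
      cos (((k + l + 2 : ℤ) : ℝ) / R * t)))
    (fun t ht => by rw [boxSine_of_notMem hR k ht, zero_mul])
    (fun t ht => ?_)]
  · rw [intervalIntegral.integral_const_mul, intervalIntegral.integral_sub,
      integral_cos_int_mul_div hR, integral_cos_int_mul_div hR]
    -- Modes are numbered from `0` with frequency `k + 1`, so the sum frequency never vanishes and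
    -- only the difference frequency can contribute.
    · have h : (k + l + 2 : ℤ) ≠ 0 := by positivity
      simp only [h, sub_eq_zero, Nat.cast_inj, if_false, sub_zero, mul_ite, mul_zero]
      split_ifs <;> ring
    · exact (by fun_prop : Continuous _).intervalIntegrable _ _
    · exact (by fun_prop : Continuous _).intervalIntegrable _ _
  · rw [boxSine_of_mem k (Set.Ioo_subset_Icc_self ht), boxSine_of_mem l (Set.Ioo_subset_Icc_self ht)]
    have h1 : ((k - l : ℤ) : ℝ) / R * t = (k + 1) / R * t - (l + 1) / R * t := by push_cast; ring
    have h2 : ((k + l + 2 : ℤ) : ℝ) / R * t = (k + 1) / R * t + (l + 1) / R * t := by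
      push_cast; ring
    rw [h1, h2, cos_sub, cos_add]
    ring

theorem integral_boxCosine_mul {R : ℝ} (hR : 0 < R) (k l : ℕ) :
    ∫ t, boxCosine R k t * boxCosine R l t =
      if k = l then ((k + 1) / R) ^ 2 * (π * R / 2) else 0 := by
  have hπR : 0 ≤ π * R := by positivity
  rw [integral_eq_intervalIntegral_of_indicator hπR
    (g := fun t => ((k + 1) / R * ((l + 1) / R) / 2) * (cos (((k - l : ℤ) : ℝ) / R * t) +
      cos (((k + l + 2 : ℤ) : ℝ) / R * t)))
    (fun t ht => by rw [boxCosine, Set.indicator_of_notMem ht, zero_mul])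
    (fun t ht => ?_)]
  · rw [intervalIntegral.integral_const_mul, intervalIntegral.integral_add,
      integral_cos_int_mul_div hR, integral_cos_int_mul_div hR]
    · have h : (k + l + 2 : ℤ) ≠ 0 := by positivity
      simp only [h, sub_eq_zero, Nat.cast_inj, if_false, add_zero, mul_ite, mul_zero]
      split_ifs with hkl
      · rw [hkl]
        ring
      · rfl
    · exact (by fun_prop : Continuous _).intervalIntegrable _ _
    · exact (by fun_prop : Continuous _).intervalIntegrable _ _
  · rw [boxCosine, boxCosine, Set.indicator_of_mem ht, Set.indicator_of_mem ht]
    have h1 : ((k - l : ℤ) : ℝ) / R * t = (k + 1) / R * t - (l + 1) / R * t := by push_cast; ring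
    have h2 : ((k + l + 2 : ℤ) : ℝ) / R * t = (k + 1) / R * t + (l + 1) / R * t := by
      push_cast; ring
    rw [h1, h2, cos_sub, cos_add]
    ring

end BoxSine

/-! ### Product modes on the cube and their orthogonality. -/

section BoxMode

open Real

variable {d : ℕ}

/-- The product Dirichlet eigenfunctions of the cube `(0, π R)^d`, extended by zero. -/
def boxMode (R : ℝ) (n : Fin d → ℕ) (x : EuclideanSpace ℝ (Fin d)) : ℝ :=
  ∏ i, boxSine R (n i) (x i)

/-- The closed cube `[0, π R]^d`. -/
def closedCube (d : ℕ) (R : ℝ) : Set (EuclideanSpace ℝ (Fin d)) :=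
  {x | ∀ i, x i ∈ Set.Icc 0 (π * R)}

theorem isCompact_closedCube (d : ℕ) (R : ℝ) : IsCompact (closedCube d R) := by
  have h : closedCube d R =
      (WithLp.toLp 2) '' Set.univ.pi fun _ : Fin d => Set.Icc (0 : ℝ) (π * R) := by
    ext x
    constructor
    · intro hx
      exact ⟨x.ofLp, fun i _ => hx i, rfl⟩
    · rintro ⟨y, hy, rfl⟩ i
      exact hy i trivial
  rw [h]
  exact (isCompact_univ_pi fun _ => isCompact_Icc).image (PiLp.continuous_toLp 2 _)

theorem boxMode_of_notMem {R : ℝ} (hR : 0 < R) (n : Fin d → ℕ) {x : EuclideanSpace ℝ (Fin d)}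
    (hx : x ∉ closedCube d R) : boxMode R n x = 0 := by
  simp only [closedCube, Set.mem_ofPred_eq, not_forall] at hx
  obtain ⟨i, hi⟩ := hx
  exact Finset.prod_eq_zero (Finset.mem_univ i)
    (boxSine_of_notMem hR _ fun h => hi (Set.Ioo_subset_Icc_self h))

theorem hasCompactSupport_boxMode {R : ℝ} (hR : 0 < R) (n : Fin d → ℕ) :
    HasCompactSupport (boxMode R n) :=
  HasCompactSupport.intro (isCompact_closedCube d R) fun _ hx => boxMode_of_notMem hR n hx

/-- Changing one factor at a time costs only that factor's Lipschitz constant, since the other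
factors are bounded by one. -/
theorem exists_lipschitzWith_prod_of_abs_le_one {X ι : Type*} [PseudoMetricSpace X] (s : Finset ι)
    {f : ι → X → ℝ} (h1 : ∀ i x, |f i x| ≤ 1) (hf : ∀ i, ∃ C, LipschitzWith C (f i)) :
    ∃ C, LipschitzWith C fun x => ∏ i ∈ s, f i x := by
  classical
  induction s using Finset.induction_on with
  | empty => exact ⟨0, by simp⟩
  | insert a s ha ih =>
    obtain ⟨C, hC⟩ := hf a
    obtain ⟨D, hD⟩ := ih
    refine ⟨C + D, LipschitzWith.of_dist_le_mul fun x y => ?_⟩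
    have hCx := hC.dist_le_mul x y
    have hDx := hD.dist_le_mul x y
    simp only [Finset.prod_insert ha, Real.dist_eq, NNReal.coe_add] at hCx hDx ⊢
    have hb : |∏ i ∈ s, f i y| ≤ 1 := by
      rw [Finset.abs_prod]
      exact Finset.prod_le_one (fun i _ => abs_nonneg _) fun i _ => h1 i y
    calc |f a x * ∏ i ∈ s, f i x - f a y * ∏ i ∈ s, f i y|
        = |f a x * (∏ i ∈ s, f i x - ∏ i ∈ s, f i y) + (f a x - f a y) * ∏ i ∈ s, f i y| := by
          congr 1
          ring
      _ ≤ |f a x| * |∏ i ∈ s, f i x - ∏ i ∈ s, f i y| + |f a x - f a y| * |∏ i ∈ s, f i y| := by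
          rw [← abs_mul, ← abs_mul]
          exact abs_add_le _ _
      _ ≤ 1 * (D * dist x y) + (C * dist x y) * 1 := by
          gcongr
          · exact h1 a x
      _ = (C + D) * dist x y := by ring

theorem exists_lipschitzWith_boxMode (R : ℝ) (n : Fin d → ℕ) :
    ∃ C, LipschitzWith C (boxMode R n) := by
  refine exists_lipschitzWith_prod_of_abs_le_one Finset.univ
    (f := fun i (x : EuclideanSpace ℝ (Fin d)) => boxSine R (n i) (x i))
    (fun i x => abs_boxSine_le_one _ _ _) fun i => ?_
  have h : LipschitzWith 1 fun x : EuclideanSpace ℝ (Fin d) => x i :=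
    LipschitzWith.of_dist_le_mul fun x y => by
      simpa [dist_eq_norm] using PiLp.norm_apply_le (x - y) i
  exact ⟨_, (lipschitzWith_boxSine R (n i)).comp h⟩

theorem integral_prod_apply_euclideanSpace (F : Fin d → ℝ → ℝ) :
    ∫ x : EuclideanSpace ℝ (Fin d), ∏ i, F i (x i) = ∏ i, ∫ t, F i t := by
  rw [← integral_fintype_prod_volume_eq_prod]
  exact (PiLp.volume_preserving_ofLp (Fin d)).integral_comp
    (MeasurableEquiv.toLp 2 (Fin d → ℝ)).symm.measurableEmbedding (fun y => ∏ i, F i (y i))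

theorem integral_boxMode_mul {R : ℝ} (hR : 0 < R) (n m : Fin d → ℕ) :
    ∫ x, boxMode R n x * boxMode R m x = if n = m then (π * R / 2) ^ d else 0 := by
  simp only [boxMode, ← Finset.prod_mul_distrib]
  rw [integral_prod_apply_euclideanSpace fun i t => boxSine R (n i) t * boxSine R (m i) t]
  simp only [integral_boxSine_mul hR]
  split_ifs with h
  · subst h
    simp only [if_true, Finset.prod_const, Finset.card_univ, Fintype.card_fin]
  · obtain ⟨i, hi⟩ := Function.ne_iff.mp h
    exact Finset.prod_eq_zero (Finset.mem_univ i) (if_neg hi)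

theorem ae_forall_apply_ne (c : ℝ) : ∀ᵐ x : EuclideanSpace ℝ (Fin d), ∀ i, x i ≠ c := by
  refine (PiLp.volume_preserving_ofLp (Fin d)).quasiMeasurePreserving.ae
    (p := fun y => ∀ i, y i ≠ c) ?_
  exact ae_all_iff.mpr fun i => Measure.ae_eval_ne (fun _ : Fin d => (volume : Measure ℝ)) i c

theorem lineDeriv_boxMode {R : ℝ} (hR : 0 < R) (n : Fin d → ℕ) {x : EuclideanSpace ℝ (Fin d)}
    (h0 : ∀ i, x i ≠ 0) (h1 : ∀ i, x i ≠ π * R) (i : Fin d) :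
    lineDeriv ℝ (boxMode R n) x (EuclideanSpace.single i 1) =
      ∏ j, if j = i then boxCosine R (n j) (x j) else boxSine R (n j) (x j) := by
  have h : ∀ j, HasDerivAt
      (fun t : ℝ => boxSine R (n j) ((x + t • EuclideanSpace.single i (1 : ℝ)) j))
      (if j = i then boxCosine R (n j) (x j) else 0) 0 := by
    intro j
    by_cases hj : j = i
    · subst hj
      have h2 := hasDerivAt_boxSine hR (n j) (h0 j) (h1 j)
      have h3 : HasDerivAt (fun t : ℝ => x j + t) 1 0 := (hasDerivAt_id 0).const_add _
      have h4 := HasDerivAt.comp (0 : ℝ) (h₂ := boxSine R (n j)) (by simpa using h2) h3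
      simpa [Function.comp_def] using h4
    · simpa [hj] using hasDerivAt_const (0 : ℝ) (boxSine R (n j) (x j))
  have hprod := HasDerivAt.fun_finsetProd (u := Finset.univ) fun j _ => h j
  rw [lineDeriv]
  refine hprod.deriv.trans ?_
  rw [Finset.sum_eq_single i (fun j _ hj => by rw [if_neg hj, smul_zero])
    fun hi => absurd (Finset.mem_univ i) hi, if_pos rfl, ← Finset.mul_prod_erase _ _
    (Finset.mem_univ i), if_pos rfl, smul_eq_mul, mul_comm]
  congr 1
  refine Finset.prod_congr rfl fun j hj => ?_
  rw [if_neg (Finset.ne_of_mem_erase hj), zero_smul, add_zero]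

/-- Each partial derivative replaces one sine factor by a cosine factor, and both families are
orthogonal in one variable. By Fubini, distinct modes are thus orthogonal for the energy as well as
in `L_2`. -/
theorem integral_gradInner_boxMode {R : ℝ} (hR : 0 < R) (n m : Fin d → ℕ) :
    ∫ x, gradInner (boxMode R n) (boxMode R m) x =
      if n = m then (∑ i, ((n i + 1) / R) ^ 2) * (π * R / 2) ^ d else 0 := by
  obtain ⟨C, hC⟩ := exists_lipschitzWith_boxMode R n
  obtain ⟨D, hD⟩ := exists_lipschitzWith_boxMode R m
  have key : ∀ i, ∫ x, lineDeriv ℝ (boxMode R n) x (EuclideanSpace.single i 1) *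
      lineDeriv ℝ (boxMode R m) x (EuclideanSpace.single i 1) =
      if n = m then ((n i + 1) / R) ^ 2 * (π * R / 2) ^ d else 0 := by
    intro i
    have h : ∀ᵐ x : EuclideanSpace ℝ (Fin d),
        lineDeriv ℝ (boxMode R n) x (EuclideanSpace.single i 1) *
        lineDeriv ℝ (boxMode R m) x (EuclideanSpace.single i 1) =
        ∏ j, (if j = i then fun t => boxCosine R (n j) t * boxCosine R (m j) t
          else fun t => boxSine R (n j) t * boxSine R (m j) t) (x j) := by
      filter_upwards [ae_forall_apply_ne (d := d) 0, ae_forall_apply_ne (d := d) (π * R)]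
        with x hx hx'
      rw [lineDeriv_boxMode hR n hx hx', lineDeriv_boxMode hR m hx hx', ← Finset.prod_mul_distrib]
      refine Finset.prod_congr rfl fun j _ => ?_
      split_ifs <;> rfl
    rw [integral_congr_ae h, integral_prod_apply_euclideanSpace]
    have h2 : ∀ j, ∫ t, (if j = i then fun t => boxCosine R (n j) t * boxCosine R (m j) t
          else fun t => boxSine R (n j) t * boxSine R (m j) t) t =
        if n j = m j then (if j = i then ((n i + 1) / R) ^ 2 else 1) * (π * R / 2) else 0 := by
      intro j
      by_cases hj : j = i
      · subst hj
        simp only [if_true, integral_boxCosine_mul hR]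
      · simp only [hj, if_false, integral_boxSine_mul hR, one_mul]
    simp only [h2]
    split_ifs with hnm
    · subst hnm
      simp only [if_true, Finset.prod_mul_distrib, Finset.prod_ite_eq', Finset.mem_univ,
        Finset.prod_const, Finset.card_univ, Fintype.card_fin]
    · obtain ⟨j, hj⟩ := Function.ne_iff.mp hnm
      exact Finset.prod_eq_zero (Finset.mem_univ j) (if_neg hj)
  simp only [gradInner]
  rw [integral_finsetSum _ fun i _ => hC.integrable_lineDeriv_mul (hasCompactSupport_boxMode hR n)
    hD (hasCompactSupport_boxMode hR m) _]
  simp only [key]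
  split_ifs with h
  · rw [Finset.sum_mul]
  · simp

end BoxMode

/-! ### Bracketing: modes of the cube against eigenvalues of the tile. -/

section ModeCount

/-- Vectors whose inner products sum to a diagonal matrix give an orthogonal expansion. -/
theorem sum_norm_sq_sum_smul_eq {𝕜 : Type*} [RCLike 𝕜] {X : Type*} [NormedAddCommGroup X]
    [InnerProductSpace 𝕜 X] {α ι : Type*} [Fintype α] [DecidableEq α] (s : Finset ι)
    (v : α → ι → X) (B : α → α → ι → ℝ) (b : α → ℝ)
    (hB : ∀ n m j, inner 𝕜 (v n j) (v m j) = (B n m j : 𝕜))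
    (hb : ∀ n m, ∑ j ∈ s, B n m j = if n = m then b n else 0) (c : α → 𝕜) :
    ∑ j ∈ s, ‖∑ n, c n • v n j‖ ^ 2 = ∑ n, ‖c n‖ ^ 2 * b n := by
  apply RCLike.ofReal_injective (K := 𝕜)
  have h1 : ∀ j, ((‖∑ n, c n • v n j‖ ^ 2 : ℝ) : 𝕜) =
      ∑ n, ∑ m, starRingEnd 𝕜 (c n) * c m * (B n m j : 𝕜) := by
    intro j
    rw [RCLike.ofReal_pow, ← inner_self_eq_norm_sq_to_K, sum_inner]
    refine Finset.sum_congr rfl fun n _ => ?_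
    rw [inner_sum]
    refine Finset.sum_congr rfl fun m _ => ?_
    rw [inner_smul_left, inner_smul_right, hB, mul_assoc]
  rw [RCLike.ofReal_sum, RCLike.ofReal_sum]
  simp only [h1]
  rw [Finset.sum_comm]
  refine Finset.sum_congr rfl fun n _ => ?_
  rw [Finset.sum_comm]
  simp only [← Finset.mul_sum, ← RCLike.ofReal_sum, hb]
  rw [Finset.sum_eq_single n (fun m _ hm => by simp [hm.symm])
    fun h => absurd (Finset.mem_univ n) h, if_pos rfl, RCLike.conj_mul, RCLike.ofReal_mul,
    RCLike.ofReal_pow]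

variable {𝕜 : Type*} [RCLike 𝕜] {d : ℕ} {Ω : Set (EuclideanSpace ℝ (Fin d))}

/-- The number of Dirichlet modes of a cube below `a` is at most the number of tiles meeting the
cube times the number of Neumann eigenvalues of the tile below `a`. -/
theorem card_le_card_mul_finrank_neumannSpectralSubspace (hopen : IsOpen Ω)
    (hcompact : IsCompactOperator (sobolevEmbedding 𝕜 Ω))
    {g : ℕ → EuclideanSpace ℝ (Fin d) ≃ᵢ EuclideanSpace ℝ (Fin d)}
    (hdisj : ∀ j k, j ≠ k → Disjoint (g j '' Ω) (g k '' Ω))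
    (hcover : volume (⋃ j, g j '' Ω)ᶜ = 0) {a R : ℝ} (ha : 0 < a) (hR : 0 < R)
    (S : Finset (Fin d → ℕ)) (hS : ∀ n ∈ S, ∑ i, (((n i : ℝ) + 1) / R) ^ 2 < a)
    (s : Finset ℕ) (hs : ∀ j ∉ s, Disjoint (g j '' Ω) (closedCube d R)) :
    S.card ≤ s.card * Module.finrank 𝕜 (neumannSpectralSubspace 𝕜 Ω a) := by
  classical
  have hfd := finiteDimensional_neumannSpectralSubspace hcompact ha
  choose C hC using fun n : Fin d → ℕ => exists_lipschitzWith_boxMode R n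
  have hL : ∀ n j, LipschitzWith (C n * 1) (boxMode R n ∘ g j) := fun n j =>
    (hC n).comp (g j).isometry.lipschitz
  have hK : ∀ n j, HasCompactSupport (boxMode R n ∘ g j) := fun n j =>
    (hasCompactSupport_boxMode hR n).comp_homeomorph (g j).toHomeomorph
  have hgrad : ∀ n m, ∑ j ∈ s, ∫ x in Ω, gradInner (boxMode R n) (boxMode R m) (g j x) =
      if n = m then (∑ i, (((n i : ℝ) + 1) / R) ^ 2) * (Real.pi * R / 2) ^ d else 0 := fun n m => by
    rw [sum_setIntegral_comp_eq_integral hopen.measurableSet hdisj hcover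
      (G := gradInner (boxMode R n) (boxMode R m)) (K := closedCube d R) ?_ (fun x hx => ?_) hs,
      integral_gradInner_boxMode hR]
    · exact (hC n).integrable_gradInner (hasCompactSupport_boxMode hR n) (hC m)
        (hasCompactSupport_boxMode hR m)
    · refine Finset.sum_eq_zero fun i _ => ?_
      rw [lineDeriv_eq_zero_of_notMem_tsupport, zero_mul]
      refine fun h => hx (closure_minimal ?_ (isCompact_closedCube d R).isClosed h)
      intro y hy
      by_contra hy'
      exact hy (boxMode_of_notMem hR n hy')
  have hfun : ∀ n m, ∑ j ∈ s, ∫ x in Ω, boxMode R n (g j x) * boxMode R m (g j x) =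
      if n = m then (Real.pi * R / 2) ^ d else 0 := fun n m => by
    rw [sum_setIntegral_comp_eq_integral hopen.measurableSet hdisj hcover
      (G := fun x => boxMode R n x * boxMode R m x) (K := closedCube d R) ?_ (fun x hx => ?_) hs,
      integral_boxMode_mul hR]
    · exact ((hC n).continuous.mul (hC m).continuous).integrable_of_hasCompactSupport
        (hasCompactSupport_boxMode hR n).mul_right
    · rw [boxMode_of_notMem hR n hx, zero_mul]
  -- `w n j` is the mode `n` on the `j`-th tile, transported to `Ω`.
  let w : S → ℕ → sobolevSpace 𝕜 Ω := fun n j => (hL n j).toSobolev 𝕜 Ω (hK n j)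
  let sndL : sobolevSpace 𝕜 Ω →L[𝕜] PiLp 2 (fun _ : Fin d => LTwo 𝕜 Ω) :=
    (WithLp.sndL 2 𝕜 _ _).comp (sobolevSpace 𝕜 Ω).subtypeL
  set κ : ℝ := (Real.pi * R / 2) ^ d
  have hκ0 : 0 < κ := by positivity
  by_contra! hlt
  let P := (neumannSpectralSubspace 𝕜 Ω a).orthogonalProjectionOnto
  -- Coefficients go to the spectral projections of their combination on all tiles. There are more
  -- coefficients than conditions, so some nonzero combination is orthogonal to the spectral
  -- subspace on every tile.
  let Φ : (S → 𝕜) →ₗ[𝕜] (s → neumannSpectralSubspace 𝕜 Ω a) := LinearMap.pi fun j =>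
    P.toLinearMap ∘ₗ (sobolevEmbedding 𝕜 Ω).toLinearMap ∘ₗ
      Fintype.linearCombination 𝕜 fun n => w n j
  have hker : LinearMap.ker Φ ≠ ⊥ := by
    refine LinearMap.ker_ne_bot_of_finrank_lt ?_
    simpa [Module.finrank_pi_fintype] using hlt
  obtain ⟨c, hc, hc0⟩ := (Submodule.ne_bot_iff _).mp hker
  have hc' : ∀ j ∈ s, (∑ n, c n • w n j).1.fst ∈ (neumannSpectralSubspace 𝕜 Ω a)ᗮ := by
    intro j hj
    have h := congrFun (LinearMap.mem_ker.mp hc) ⟨j, hj⟩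
    exact Submodule.orthogonalProjectionOnto_eq_zero_iff.mp h
  have hle : a * ∑ j ∈ s, ‖∑ n, c n • sobolevEmbedding 𝕜 Ω (w n j)‖ ^ 2 ≤
      ∑ j ∈ s, ‖∑ n, c n • sndL (w n j)‖ ^ 2 := by
    rw [Finset.mul_sum]
    refine Finset.sum_le_sum fun j hj => ?_
    have h := mul_norm_sq_le_of_mem_orthogonal_neumannSpectralSubspace hcompact ha _ (hc' j hj)
    have h1 : ∑ n, c n • sobolevEmbedding 𝕜 Ω (w n j) = (∑ n, c n • w n j).1.fst := by
      simp only [← map_smul, ← map_sum]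
      rfl
    have h2 : ∑ n, c n • sndL (w n j) = (∑ n, c n • w n j).1.snd := by
      simp only [← map_smul, ← map_sum]
      rfl
    rwa [h1, h2]
  rw [sum_norm_sq_sum_smul_eq s (fun n j => sobolevEmbedding 𝕜 Ω (w n j))
      (fun n m j => ∫ x in Ω, boxMode R n (g j x) * boxMode R m (g j x)) (fun _ => κ)
      (fun n m j => (hL n j).inner_toSobolev_fst 𝕜 Ω (hK n j) (hL m j) (hK m j)) ?_,
    sum_norm_sq_sum_smul_eq s (fun n j => sndL (w n j))
      (fun n m j => ∫ x in Ω, gradInner (boxMode R n) (boxMode R m) (g j x))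
      (fun n => (∑ i, (((n : Fin d → ℕ) i + 1) / R) ^ 2) * κ) ?_ ?_, Finset.mul_sum] at hle
  -- After diagonalisation, `hle` compares `a` with a weighted mean of mode eigenvalues, all
  -- strictly below `a`; a nonzero coefficient makes this contradictory.
  · refine absurd hle (not_le.mpr ?_)
    obtain ⟨n₀, hn₀⟩ := Function.ne_iff.mp hc0
    refine Finset.sum_lt_sum (fun n _ => ?_) ⟨n₀, Finset.mem_univ _, ?_⟩
    · have := mul_le_mul_of_nonneg_right (hS n n.2).le hκ0.le
      nlinarith [mul_le_mul_of_nonneg_left this (sq_nonneg ‖c n‖)]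
    · have h0 : 0 < ‖c n₀‖ ^ 2 := by
        have : 0 < ‖c n₀‖ := norm_pos_iff.mpr hn₀
        positivity
      have := mul_lt_mul_of_pos_right (hS n₀ n₀.2) hκ0
      nlinarith [mul_lt_mul_of_pos_left this h0]
  · intro n m j
    refine ((hL n j).inner_toSobolev_snd 𝕜 Ω (hK n j) (hL m j) (hK m j)).trans ?_
    congr 1
    exact integral_congr_ae (ae_restrict_of_ae (gradInner_comp_ae (hC n) (hC m) (g j)))
  · intro n m
    simp only [hgrad, Subtype.ext_iff]
  · intro n m
    simp only [hfun, Subtype.ext_iff]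

end ModeCount

/-! ### Counting the tiles that meet a cube. -/

section TileCount

variable {d : ℕ}

theorem volume_setOf_forall_mem_Icc (a b : Fin d → ℝ) :
    volume {x : EuclideanSpace ℝ (Fin d) | ∀ i, x i ∈ Set.Icc (a i) (b i)} =
      ∏ i, ENNReal.ofReal (b i - a i) := by
  have h := (PiLp.volume_preserving_ofLp (Fin d)).measure_preimage
    (s := Set.univ.pi fun i => Set.Icc (a i) (b i)) (MeasurableSet.univ_pi fun _ =>
      measurableSet_Icc).nullMeasurableSet
  have h1 : {x : EuclideanSpace ℝ (Fin d) | ∀ i, x i ∈ Set.Icc (a i) (b i)} =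
      WithLp.ofLp ⁻¹' Set.univ.pi fun i => Set.Icc (a i) (b i) := by
    ext x
    exact ⟨fun hx i _ => hx i, fun hx i => hx i trivial⟩
  rw [h1, h, volume_pi_pi]
  simp

/-- Only finitely many tiles meet a cube, and their total volume is at most that of a slightly
larger cube. -/
theorem exists_finset_tiles {Ω : Set (EuclideanSpace ℝ (Fin d))} (hopen : IsOpen Ω)
    (hne : Ω.Nonempty) {D : ℝ} (hD0 : 0 ≤ D) (hD : ∀ x ∈ Ω, ∀ y ∈ Ω, dist x y ≤ D)
    {g : ℕ → EuclideanSpace ℝ (Fin d) ≃ᵢ EuclideanSpace ℝ (Fin d)}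
    (hdisj : ∀ j k, j ≠ k → Disjoint (g j '' Ω) (g k '' Ω)) {R : ℝ} (hR : 0 < R) :
    ∃ s : Finset ℕ, (∀ j ∉ s, Disjoint (g j '' Ω) (closedCube d R)) ∧
      s.card * volume.real Ω ≤ (Real.pi * R + 2 * D) ^ d := by
  -- The cube enlarged by `D` on every side: it contains each tile that meets the original cube.
  set Q : Set (EuclideanSpace ℝ (Fin d)) := {x | ∀ i, x i ∈ Set.Icc (-D) (Real.pi * R + D)}
  have hπR : 0 < Real.pi * R := by positivity
  have hQ : volume Q = ENNReal.ofReal ((Real.pi * R + 2 * D) ^ d) := by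
    have h : Real.pi * R + D - -D = Real.pi * R + 2 * D := by ring
    rw [volume_setOf_forall_mem_Icc (fun _ => -D) fun _ => Real.pi * R + D]
    simp only [h, Finset.prod_const, Finset.card_univ, Fintype.card_fin]
    rw [ENNReal.ofReal_pow (by positivity)]
  set T : Set ℕ := {j | ¬ Disjoint (g j '' Ω) (closedCube d R)}
  have hT : ∀ j ∈ T, g j '' Ω ⊆ Q := by
    rintro j hj _ ⟨y, hy, rfl⟩ i
    obtain ⟨_, ⟨z, hz, rfl⟩, hz'⟩ := Set.not_disjoint_iff.mp hj
    have h1 : dist (g j y) (g j z) ≤ D := by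
      rw [(g j).dist_eq]
      exact hD y hy z hz
    have h2 : |g j y i - g j z i| ≤ D := by
      rw [dist_eq_norm] at h1
      exact (PiLp.norm_apply_le (g j y - g j z) i).trans h1
    have h3 := hz' i
    rw [abs_le] at h2
    exact ⟨by linarith [h3.1], by linarith [h3.2]⟩
  have hΩ : volume Ω ≠ 0 := (hopen.measure_pos volume hne).ne'
  have key : ∀ s : Finset ℕ, (∀ j ∈ s, j ∈ T) → (s.card : ENNReal) * volume Ω ≤ volume Q := by
    intro s hs
    have hvol : ∀ j, volume (g j '' Ω) = volume Ω := fun j => by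
      rw [← (g j).measurePreserving_volume.measure_preimage_emb
        (g j).toHomeomorph.measurableEmbedding, Set.preimage_image_eq _ (g j).injective]
    calc (s.card : ENNReal) * volume Ω = ∑ j ∈ s, volume (g j '' Ω) := by simp [hvol]
      _ = volume (⋃ j ∈ s, g j '' Ω) := by
          refine (measure_biUnion_finset (fun j _ k _ hjk => hdisj j k hjk) fun j _ => ?_).symm
          exact (g j).toHomeomorph.measurableEmbedding.measurableSet_image.mpr hopen.measurableSet
      _ ≤ volume Q := measure_mono (Set.iUnion₂_subset fun j hj => hT j (hs j hj))
  have hfin : T.Finite := by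
    by_contra hinf
    have hall : ∀ n : ℕ, (n : ENNReal) * volume Ω ≤ volume Q := by
      intro n
      obtain ⟨s, hs, hcard⟩ := Set.Infinite.exists_subset_card_eq hinf n
      rw [← hcard]
      exact key s fun j hj => hs hj
    have hQtop : volume Q < ⊤ := by
      rw [hQ]
      exact ENNReal.ofReal_lt_top
    obtain ⟨n, hn⟩ := ENNReal.exists_nat_mul_gt hΩ hQtop.ne
    exact absurd (hall n) (not_le.mpr hn)
  refine ⟨hfin.toFinset, fun j hj => ?_, ?_⟩
  · by_contra h
    exact hj (hfin.mem_toFinset.mpr h)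
  · have h := key hfin.toFinset fun j hj => hfin.mem_toFinset.mp hj
    rw [hQ] at h
    have h2 := ENNReal.toReal_mono ENNReal.ofReal_ne_top h
    rwa [ENNReal.toReal_mul, ENNReal.toReal_natCast, ENNReal.toReal_ofReal (by positivity)] at h2

end TileCount

/-! ### Counting positive lattice points in a ball. -/

section LatticeCount

variable {d : ℕ}

/-- Covering a ball by unit cubes in all orthants bounds its volume by the number of lattice points
with positive coordinates in a slightly larger ball. -/
theorem volume_ball_le_two_pow_mul_card {r ρ : ℝ} (hr : r + √d ≤ ρ) (S : Finset (Fin d → ℕ))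
    (hS : ∀ n : Fin d → ℕ, ∑ i, ((n i : ℝ) + 1) ^ 2 < ρ ^ 2 → n ∈ S) :
    volume.real (Metric.ball (0 : EuclideanSpace ℝ (Fin d)) r) ≤ 2 ^ d * S.card := by
  -- The lower corner of a unit cube: `p.1` locates the cube in the positive orthant and `p.2`
  -- reflects it into the orthant with those signs.
  let a : (Fin d → ℕ) × (Fin d → Bool) → Fin d → ℝ := fun p i =>
    if p.2 i then (p.1 i : ℝ) else -(p.1 i + 1)
  let cube : (Fin d → ℕ) × (Fin d → Bool) → Set (EuclideanSpace ℝ (Fin d)) := fun p =>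
    {x | ∀ i, x i ∈ Set.Icc (a p i) (a p i + 1)}
  have hcube : ∀ p, volume (cube p) = 1 := fun p => by
    rw [volume_setOf_forall_mem_Icc (a p) fun i => a p i + 1]
    simp
  have hsub : Metric.ball (0 : EuclideanSpace ℝ (Fin d)) r ⊆
      ⋃ p ∈ S ×ˢ (Finset.univ : Finset (Fin d → Bool)), cube p := by
    intro x hx
    have hxr : ‖x‖ < r := by simpa using hx
    refine Set.mem_biUnion (x := (fun i => ⌊|x i|⌋₊, fun i => decide (0 ≤ x i))) ?_ ?_
    · simp only [Finset.coe_product, Finset.coe_univ, Set.mem_prod, Set.mem_univ, and_true,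
        Finset.mem_coe]
      refine hS _ ?_
      let y : EuclideanSpace ℝ (Fin d) := WithLp.toLp 2 fun i => |x i|
      -- The outer corner of the cube containing `x` is dominated coordinatewise by `|x| + (1, …,
      -- 1)`; the second vector has norm `√d`, hence the margin between `r` and `ρ`.
      let z : EuclideanSpace ℝ (Fin d) := WithLp.toLp 2 fun _ => 1
      have hy : ‖y‖ = ‖x‖ := by simp [EuclideanSpace.norm_eq, y]
      have hz : ‖z‖ = √d := by simp [EuclideanSpace.norm_eq, z]
      have h1 : ‖y + z‖ < ρ := by linarith [norm_add_le y z]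
      have h2 : ‖y + z‖ ^ 2 = ∑ i, (|x i| + 1) ^ 2 := by
        rw [EuclideanSpace.norm_sq_eq]
        simp [y, z]
      calc ∑ i, ((⌊|x i|⌋₊ : ℝ) + 1) ^ 2 ≤ ∑ i, (|x i| + 1) ^ 2 := by
            refine Finset.sum_le_sum fun i _ => ?_
            have := Nat.floor_le (abs_nonneg (x i))
            gcongr
        _ = ‖y + z‖ ^ 2 := h2.symm
        _ < ρ ^ 2 := by gcongr
    · intro i
      have h1 := Nat.floor_le (abs_nonneg (x i))
      have h2 := Nat.lt_floor_add_one |x i|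
      by_cases h : 0 ≤ x i
      · simp only [a, h, decide_true, if_true]
        rw [abs_of_nonneg h] at h1 h2 ⊢
        exact ⟨h1, h2.le⟩
      · simp only [a, h, decide_false, Bool.false_eq_true, if_false]
        rw [abs_of_neg (not_le.mp h)] at h1 h2 ⊢
        exact ⟨by linarith, by linarith⟩
  have h := (measure_mono hsub).trans
    (measure_biUnion_finset_le (μ := volume) (S ×ˢ (Finset.univ : Finset (Fin d → Bool))) cube)
  simp only [hcube, Finset.sum_const, Finset.card_product, Finset.card_univ, Fintype.card_pi,
    Fintype.card_bool, Finset.prod_const, Fintype.card_fin, nsmul_eq_mul, mul_one] at h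
  have h3 := ENNReal.toReal_mono (ENNReal.natCast_ne_top _) h
  rw [ENNReal.toReal_natCast] at h3
  rw [mul_comm]
  exact_mod_cast h3

theorem exists_finset_mem_iff_sum_sq_lt (ρ : ℝ) :
    ∃ S : Finset (Fin d → ℕ), ∀ n, n ∈ S ↔ ∑ i, ((n i : ℝ) + 1) ^ 2 < ρ ^ 2 := by
  have hfin : {n : Fin d → ℕ | ∑ i, ((n i : ℝ) + 1) ^ 2 < ρ ^ 2}.Finite := by
    refine (Set.Finite.pi' fun _ : Fin d => Set.finite_Iio ⌈|ρ|⌉₊).subset fun n hn i => ?_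
    have h1 : ((n i : ℝ) + 1) ^ 2 ≤ ∑ i, ((n i : ℝ) + 1) ^ 2 :=
      Finset.single_le_sum (f := fun i => ((n i : ℝ) + 1) ^ 2) (fun i _ => sq_nonneg _)
        (Finset.mem_univ i)
    have h2 : (n i : ℝ) + 1 < |ρ| := by
      refine lt_of_pow_lt_pow_left₀ 2 (abs_nonneg _) ?_
      rw [sq_abs]
      exact h1.trans_lt hn
    have h3 : (n i : ℝ) < ⌈|ρ|⌉₊ := by linarith [Nat.le_ceil |ρ|]
    exact_mod_cast h3
  exact ⟨hfin.toFinset, fun n => hfin.mem_toFinset⟩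

theorem volume_real_ball_eq {r : ℝ} (hr : 0 < r) :
    volume.real (Metric.ball (0 : EuclideanSpace ℝ (Fin d)) r) =
      r ^ d * volume.real (Metric.ball (0 : EuclideanSpace ℝ (Fin d)) 1) := by
  rw [measureReal_def, Measure.addHaar_ball_of_pos volume _ hr, ENNReal.toReal_mul,
    ENNReal.toReal_ofReal (by positivity), finrank_euclideanSpace_fin, measureReal_def]

end LatticeCount

/-! ### The limit of large cubes and the eigenvalue bound. -/

section Weyl

variable {𝕜 : Type*} [RCLike 𝕜] {d : ℕ} {Ω : Set (EuclideanSpace ℝ (Fin d))}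

theorem IsTilingSet.nonempty (h : IsTilingSet Ω) : Ω.Nonempty := by
  obtain ⟨g, -, hg⟩ := h
  by_contra hne
  rw [Set.not_nonempty_iff_eq_empty] at hne
  simp only [hne, Set.image_empty, Set.iUnion_empty, Set.compl_empty] at hg
  exact (isOpen_univ.measure_pos volume Set.univ_nonempty).ne' hg

/-- Comparison of the Dirichlet spectrum of a cube with the Neumann spectrum of a tile. -/
theorem rpow_mul_volume_le_finrank_mul (hopen : IsOpen Ω) (hbdd : Bornology.IsBounded Ω)
    (htiling : IsTilingSet Ω) (hcompact : IsCompactOperator (sobolevEmbedding 𝕜 Ω))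
    {a R : ℝ} (ha : 0 < a) (hR : 0 < R) (hRd : √d < √a * R) :
    (√a * R - √d) ^ d * volume.real (Metric.ball (0 : EuclideanSpace ℝ (Fin d)) 1) *
        volume.real Ω ≤
      2 ^ d * Module.finrank 𝕜 (neumannSpectralSubspace 𝕜 Ω a) *
        (Real.pi * R + 2 * Metric.diam Ω) ^ d := by
  have hne := htiling.nonempty
  obtain ⟨g, hdisj, hcover⟩ := htiling
  obtain ⟨s, hs, hcard⟩ := exists_finset_tiles hopen hne Metric.diam_nonneg
    (fun x hx y hy => Metric.dist_le_diam_of_mem hbdd hx hy) hdisj hR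
  obtain ⟨S, hS⟩ := exists_finset_mem_iff_sum_sq_lt (d := d) (√a * R)
  have h1 := volume_ball_le_two_pow_mul_card (r := √a * R - √d) (ρ := √a * R) (by simp) S
    fun n hn => (hS n).mpr hn
  rw [volume_real_ball_eq (by linarith)] at h1
  have h2 := card_le_card_mul_finrank_neumannSpectralSubspace hopen hcompact hdisj hcover ha hR S
    (fun n hn => by
      have h := (hS n).mp hn
      rw [mul_pow, Real.sq_sqrt ha.le] at h
      simp only [div_pow, ← Finset.sum_div]
      rwa [div_lt_iff₀ (by positivity)]) s hs
  have h3 : (S.card : ℝ) ≤ s.card * Module.finrank 𝕜 (neumannSpectralSubspace 𝕜 Ω a) := by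
    exact_mod_cast h2
  calc _ ≤ 2 ^ d * (S.card : ℝ) * volume.real Ω := by gcongr
    _ ≤ 2 ^ d * (s.card * Module.finrank 𝕜 (neumannSpectralSubspace 𝕜 Ω a)) * volume.real Ω := by
        gcongr
    _ = 2 ^ d * Module.finrank 𝕜 (neumannSpectralSubspace 𝕜 Ω a) * (s.card * volume.real Ω) := by
        ring
    _ ≤ _ := by gcongr

/-- The Weyl-type lower bound for the dimension of the spectral subspaces of a tiling domain. -/
theorem le_finrank_neumannSpectralSubspace (hopen : IsOpen Ω) (hbdd : Bornology.IsBounded Ω)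
    (htiling : IsTilingSet Ω) (hcompact : IsCompactOperator (sobolevEmbedding 𝕜 Ω))
    {a : ℝ} (ha : 0 < a) :
    volume.real (Metric.ball (0 : EuclideanSpace ℝ (Fin d)) 1) * volume.real Ω /
        (2 * Real.pi) ^ d * a ^ ((d : ℝ) / 2) ≤
      Module.finrank 𝕜 (neumannSpectralSubspace 𝕜 Ω a) := by
  set B := volume.real (Metric.ball (0 : EuclideanSpace ℝ (Fin d)) 1)
  set N : ℝ := ((Module.finrank 𝕜 (neumannSpectralSubspace 𝕜 Ω a) : ℕ) : ℝ)
  -- The comparison inequality divided by `R ^ d`, ready for the limit `R → ∞`.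
  have hev : ∀ᶠ R : ℝ in atTop, (√a - √d * R⁻¹) ^ d * B * volume.real Ω ≤
      2 ^ d * N * (Real.pi + 2 * Metric.diam Ω * R⁻¹) ^ d := by
    filter_upwards [eventually_gt_atTop 0, eventually_gt_atTop (√d / √a)] with R hR hR'
    have hsa : 0 < √a := Real.sqrt_pos.mpr ha
    rw [div_lt_iff₀' hsa] at hR'
    have h := rpow_mul_volume_le_finrank_mul hopen hbdd htiling hcompact ha hR hR'
    have h1 : √a * R - √d = (√a - √d * R⁻¹) * R := by field_simp
    have h2 : Real.pi * R + 2 * Metric.diam Ω = (Real.pi + 2 * Metric.diam Ω * R⁻¹) * R := by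
      field_simp
    rw [h1, h2, mul_pow, mul_pow] at h
    refine le_of_mul_le_mul_right ?_ (pow_pos hR d)
    linarith
  have hinv : Tendsto (fun R : ℝ => R⁻¹) atTop (𝓝 0) := tendsto_inv_atTop_zero
  have hl : Tendsto (fun R : ℝ => (√a - √d * R⁻¹) ^ d * B * volume.real Ω) atTop
      (𝓝 ((√a - √d * 0) ^ d * B * volume.real Ω)) :=
    (((tendsto_const_nhds.sub (hinv.const_mul _)).pow d).mul_const _).mul_const _
  have hr : Tendsto (fun R : ℝ => 2 ^ d * N * (Real.pi + 2 * Metric.diam Ω * R⁻¹) ^ d) atTop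
      (𝓝 (2 ^ d * N * (Real.pi + 2 * Metric.diam Ω * 0) ^ d)) :=
    ((tendsto_const_nhds.add (hinv.const_mul _)).pow d).const_mul _
  have hlim := le_of_tendsto_of_tendsto hl hr hev
  have hpow : a ^ ((d : ℝ) / 2) = √a ^ d := by
    rw [Real.sqrt_eq_rpow, ← Real.rpow_natCast, ← Real.rpow_mul ha.le]
    congr 1
    ring
  rw [mul_zero, sub_zero, mul_zero, add_zero] at hlim
  rw [hpow, div_mul_eq_mul_div, div_le_iff₀ (by positivity), mul_pow]
  linarith

/-- Inversion of the counting bound into an eigenvalue bound. -/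
theorem le_rpow_of_mul_rpow_le {d : ℕ} (hd : 1 ≤ d) {V a k : ℝ} (hV : 0 < V) (ha : 0 < a)
    (hk : 0 ≤ k) (h : V / (2 * Real.pi) ^ d * a ^ ((d : ℝ) / 2) ≤ k) :
    a ≤ 4 * Real.pi ^ 2 / V ^ (2 / (d : ℝ)) * k ^ (2 / (d : ℝ)) := by
  have hd0 : (d : ℝ) ≠ 0 := by positivity
  have hπ : (0 : ℝ) < 2 * Real.pi := by positivity
  have h1 : a ^ ((d : ℝ) / 2) ≤ k * (2 * Real.pi) ^ d / V := by
    rw [le_div_iff₀ hV]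
    rw [div_mul_eq_mul_div, div_le_iff₀ (by positivity)] at h
    linarith
  have h2 := Real.rpow_le_rpow (by positivity) h1 (by positivity : 0 ≤ 2 / (d : ℝ))
  rw [← Real.rpow_mul ha.le, div_mul_div_cancel₀ two_ne_zero, div_self hd0, Real.rpow_one,
    Real.div_rpow (by positivity) hV.le, Real.mul_rpow hk (by positivity), ← Real.rpow_natCast,
    ← Real.rpow_mul hπ.le, mul_div_cancel₀ _ hd0] at h2
  refine h2.trans_eq ?_
  rw [show ((2 : ℝ)) = ((2 : ℕ) : ℝ) by norm_num, Real.rpow_natCast]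
  push_cast
  ring

end Weyl

end

theorem theorem8 (𝕜 : Type*) [RCLike 𝕜] (d : ℕ) (hd : 1 ≤ d)
    (Ω : Set (EuclideanSpace ℝ (Fin d)))
    (hopen : IsOpen Ω) (hbdd : Bornology.IsBounded Ω) (htiling : IsTilingSet Ω)
    (hcompact : IsCompactOperator (sobolevEmbedding 𝕜 Ω)) :
    (∃ μ : ℕ → ℝ, IsNeumannEigenvalueSequence 𝕜 Ω μ) ∧
    ∀ μ : ℕ → ℝ, IsNeumannEigenvalueSequence 𝕜 Ω μ →
      (∀ k : ℕ, μ k ≤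
        4 * Real.pi ^ 2 /
          (volume.real (Metric.ball (0 : EuclideanSpace ℝ (Fin d)) 1) * volume.real Ω) ^
            (2 / (d : ℝ)) * (k : ℝ) ^ (2 / (d : ℝ))) ∧
      (∀ lam : ℝ, 0 < lam →
        {k : ℕ | μ k < lam}.Finite ∧
        volume.real (Metric.ball (0 : EuclideanSpace ℝ (Fin d)) 1) * volume.real Ω /
          (2 * Real.pi) ^ d * lam ^ ((d : ℝ) / 2) ≤ ({k : ℕ | μ k < lam}.ncard : ℝ)) := by
  have hlower : ∀ a : ℝ, 0 < a → _ := fun a ha =>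
    le_finrank_neumannSpectralSubspace (𝕜 := 𝕜) hopen hbdd htiling hcompact ha
  have hV : 0 < volume.real (Metric.ball (0 : EuclideanSpace ℝ (Fin d)) 1) * volume.real Ω := by
    refine mul_pos ?_ ?_
    · exact ENNReal.toReal_pos (Metric.measure_ball_pos _ _ one_pos).ne' measure_ball_lt_top.ne
    · exact ENNReal.toReal_pos (hopen.measure_pos volume htiling.nonempty).ne'
        hbdd.measure_lt_top.ne
  refine ⟨exists_isNeumannEigenvalueSequence hcompact fun n => ?_, fun μ hμ => ⟨fun k => ?_,
    fun a ha => ⟨hμ.finite_lt a, ?_⟩⟩⟩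
  -- The lower bound grows without limit in `a`, so the spectral subspaces have unbounded dimension.
  · have hd2 : 0 < (d : ℝ) / 2 := by positivity
    have ht := (tendsto_rpow_atTop hd2).const_mul_atTop
      (show 0 < volume.real (Metric.ball (0 : EuclideanSpace ℝ (Fin d)) 1) * volume.real Ω /
        (2 * Real.pi) ^ d by positivity)
    obtain ⟨a, ha, ha0⟩ := ((ht.eventually_gt_atTop (n : ℝ)).and (eventually_gt_atTop 0)).exists
    exact ⟨a, by exact_mod_cast ha.trans_le (hlower a ha0)⟩
  · rcases le_or_gt (μ k) 0 with h0 | h0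
    · refine h0.trans ?_
      positivity
    · refine le_rpow_of_mul_rpow_le hd hV h0 (Nat.cast_nonneg k) ((hlower _ h0).trans ?_)
      rw [← hμ.ncard_lt hcompact]
      -- The count is strict, so by monotonicity it sees only indices below `k`; with numbering from
      -- `0` these are exactly `k` in number. This gives `k`, not `k + 1`, in the bound.
      have hsub : {j | μ j < μ k} ⊆ Set.Iio k := fun j hj =>
        not_le.mp fun hkj => absurd (hμ.monotone hkj) (not_le.mpr hj)
      have h := Set.ncard_le_ncard hsub (Set.finite_Iio k)
      rw [Set.ncard_eq_toFinset_card' (Set.Iio k)] at h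
      exact_mod_cast (by simpa using h : _ ≤ k)
  · rw [hμ.ncard_lt hcompact]
    exact hlower a ha
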